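/- Let $\mathcal{S}$ be the $\mathbb{Q}$-algebra of formal power series of bounded degree in variables $x_1,x_2,\ldots$ and $\theta_1,\theta_2,\ldots$ subject to the relations $x_i\theta_j=\theta_jx_i$ and $\theta_i\theta_j=-\theta_j\theta_i$ for all $i,j$ (the $x_i$ do not commute with each other). A permutation $\sigma$ of the indices moving only finitely many of them acts on $\mathcal{S}$ by $x_i\mapsto x_{\sigma(i)}$, $\theta_i\mapsto\theta_{\sigma(i)}$; let $\mathrm{sNCSym}\subseteq\mathcal{S}$ be the subalgebra of the elements fixed by all such $\sigma$. A *partial set supercomposition* of bidegree $(n,m)$, where $n\ge 0$ and $0\le m\le n+1$, is a tuple $K=(K_1,\ldots,K_q)$ of nonempty subsets (blocks) of $\{0,1,\ldots,n\}$, whose union contains $\{1,\ldots,n\}$, such that $K_i\cap K_j\subseteq\{0\}$ for $i\ne j$, the blocks containing $0$ are exactly $K_1,\ldots,K_m$ (the fermionic blocks), and $\min K_i<\min K_j$ for $m<i<j\le q$. It is a *set superpartition* if moreover $K_i\ne K_j$ and $\min(K_i\setminus K_j)<\min(K_j\setminus K_i)$ for all $i<j$, where $\min\emptyset:=0$. For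 $K,L$ of the same bidegree $(n,m)$ write $K\sqsubseteq L$ if, for each $i\le m$, $L_i$ is the union of $K_i$ and some (possibly no) nonfermionic blocks of $K$, and each nonfermionic block of $L$ is a union of nonfermionic blocks of $K$. This is a partial order with meets, denoted $K\sqcap L$. Put $K!=|K_1|!\cdots|K_q|!$. For $K$ of bidegree $(n,m)$ let * $p_K=\sum\theta_{a_1}\cdots\theta_{a_m}x_{b_1}\cdots x_{b_n}$ (power sum function) over all $(a_1,\ldots,a_m,b_1,\ldots,b_n)$ with $a_i=b_j$ whenever $j\in K_i\setminus\{0\}$ (for $i\le m$), and $b_i=b_j$ whenever $i,j$ are in the same block of $K$; * $e_K=\sum\theta_{a_1}\cdots\theta_{a_m}x_{b_1}\cdots x_{b_n}$ (elementary function) over all $(a_1,\ldots,a_m,b_1,\ldots,b_n)$ with $a_i\ne b_j$ whenever $j\in K_i\setminus\{0\}$ (for $i\le m$), and $b_i\ne b_j$ whenever $i\ne j$ are in the same block of $K$; * $h_K=\sum_u (K\sqcap L_u)!\,u$ (complete homogeneous function) over all words $u=\theta_{a_1}\cdots\theta_{a_m}x_{b_1}\cdots x_{b_n}$ with distinct $a_1,\ldots,a_m$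 for which $\{a_1,\ldots,a_m\}\setminus\{b_1,\ldots,b_n\}$ has at most one element, where $L_u$ is the unique partial set supercomposition of bidegree $(n,m)$ such that $a_i=b_j$ if and only if $j\in (L_u)_i$ (for $i\le m$, $1\le j\le n$), and $b_i=b_j$ if and only if $i,j$ are in the same block of $L_u$. **Theorem.** Each of the families $(p_I)_I$, $(e_I)_I$ and $(h_I)_I$, where $I$ runs over all set superpartitions of all bidegrees $(n,m)$, is a basis of the $\mathbb{Q}$-vector space $\mathrm{sNCSym}$. -/

import Mathlib

namespace Superspace

/-! ### Formal power series in noncommuting variables in superspace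

The variables are `x i` and `θ i` for `i : ℕ`.  Modulo `x i * θ j = θ j * x i` and
`θ i * θ j = - θ j * θ i`, every monomial is a scalar times a unique `θ_S * x_w`, where `S` is a
finite set, `θ_S` is the product of the `θ i`, `i ∈ S`, in increasing order of `i`, and `w` is
a word.  A formal power series is the family of its coefficients at these normal forms. -/

/-- Formal power series: `f S w` is the coefficient of `f` at `θ_S * x_w`. -/
def Series : Type := Finset ℕ → List ℕ → ℚ

namespace Series

instance : AddCommGroup Series := inferInstanceAs (AddCommGroup (Finset ℕ → List ℕ → ℚ))

instance : Module ℚ Series := inferInstanceAs (Module ℚ (Finset ℕ → List ℕ → ℚ))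

@[ext] theorem ext {f g : Series} (h : ∀ S w, f S w = g S w) : f = g :=
  funext fun S => funext fun w => h S w

@[simp] theorem add_apply (f g : Series) (S : Finset ℕ) (w : List ℕ) :
    (f + g) S w = f S w + g S w := rfl

@[simp] theorem smul_apply (c : ℚ) (f : Series) (S : Finset ℕ) (w : List ℕ) :
    (c • f) S w = c * f S w := rfl

@[simp] theorem zero_apply (S : Finset ℕ) (w : List ℕ) : (0 : Series) S w = 0 := rfl

/-- The scalar `ε` with `θ_A * θ_B = ε • θ_(A ∪ B)`. -/
def crossSign (A B : Finset ℕ) : ℚ :=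
  ∏ a ∈ A, ∏ b ∈ B, if a < b then 1 else if b < a then -1 else 0

instance : One Series := ⟨fun S w => if S = ∅ ∧ w = [] then 1 else 0⟩

theorem one_apply (S : Finset ℕ) (w : List ℕ) :
    (1 : Series) S w = if S = ∅ ∧ w = [] then 1 else 0 := rfl

/-- The product: `(θ_A * x_u) * (θ_B * x_v) = crossSign A B • (θ_(A ∪ B) * x_(u ++ v))`. -/
instance : Mul Series := ⟨fun f g S w =>
  ∑ A ∈ S.powerset, ∑ k ∈ Finset.range (w.length + 1),
    crossSign A (S \ A) * f A (w.take k) * g (S \ A) (w.drop k)⟩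

theorem mul_apply (f g : Series) (S : Finset ℕ) (w : List ℕ) :
    (f * g) S w = ∑ A ∈ S.powerset, ∑ k ∈ Finset.range (w.length + 1),
      crossSign A (S \ A) * f A (w.take k) * g (S \ A) (w.drop k) := rfl

theorem crossSign_empty_left (B : Finset ℕ) : crossSign ∅ B = 1 := by simp [crossSign]

theorem crossSign_empty_right (A : Finset ℕ) : crossSign A ∅ = 1 := by simp [crossSign]

theorem crossSign_union_left {A B : Finset ℕ} (h : Disjoint A B) (C : Finset ℕ) :
    crossSign (A ∪ B) C = crossSign A C * crossSign B C := by
  simp only [crossSign]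
  rw [Finset.prod_union h]

theorem crossSign_union_right (A : Finset ℕ) {B C : Finset ℕ} (h : Disjoint B C) :
    crossSign A (B ∪ C) = crossSign A B * crossSign A C := by
  simp only [crossSign]
  rw [← Finset.prod_mul_distrib]
  exact Finset.prod_congr rfl fun a _ => Finset.prod_union h

theorem sum_split_set (S : Finset ℕ) (F : Finset ℕ → Finset ℕ → Finset ℕ → ℚ) :
    ∑ D ∈ S.powerset, ∑ A ∈ D.powerset, F A (D \ A) (S \ D) =
      ∑ A ∈ S.powerset, ∑ B ∈ (S \ A).powerset, F A B ((S \ A) \ B) := by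
  rw [Finset.sum_sigma', Finset.sum_sigma']
  refine Finset.sum_nbij' (fun p => ⟨p.2, p.1 \ p.2⟩) (fun p => ⟨p.1 ∪ p.2, p.1⟩) ?_ ?_ ?_ ?_ ?_
  · rintro ⟨D, A⟩ h
    simp only [Finset.mem_sigma, Finset.mem_powerset] at h ⊢
    exact ⟨h.2.trans h.1, Finset.sdiff_subset_sdiff h.1 le_rfl⟩
  · rintro ⟨A, B⟩ h
    simp only [Finset.mem_sigma, Finset.mem_powerset] at h ⊢
    exact ⟨Finset.union_subset h.1 (h.2.trans Finset.sdiff_subset), Finset.subset_union_left⟩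
  · rintro ⟨D, A⟩ h
    simp only [Finset.mem_sigma, Finset.mem_powerset] at h ⊢
    rw [Finset.union_sdiff_of_subset h.2]
  · rintro ⟨A, B⟩ h
    simp only [Finset.mem_sigma, Finset.mem_powerset] at h ⊢
    have : (A ∪ B) \ A = B := by
      rw [Finset.union_sdiff_left]
      exact Finset.sdiff_eq_self_of_disjoint
        (Finset.disjoint_of_subset_left h.2 Finset.sdiff_disjoint)
    rw [this]
  · rintro ⟨D, A⟩ h
    simp only [Finset.mem_sigma, Finset.mem_powerset] at h ⊢
    have : (S \ A) \ (D \ A) = S \ D := by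
      ext x
      simp only [Finset.mem_sdiff]
      have := @h.2 x
      tauto
    rw [this]

theorem sum_split_list (w : List ℕ) (G : List ℕ → List ℕ → List ℕ → ℚ) :
    ∑ k ∈ Finset.range (w.length + 1), ∑ j ∈ Finset.range ((w.take k).length + 1),
        G ((w.take k).take j) ((w.take k).drop j) (w.drop k) =
      ∑ j ∈ Finset.range (w.length + 1), ∑ i ∈ Finset.range ((w.drop j).length + 1),
        G (w.take j) ((w.drop j).take i) ((w.drop j).drop i) := by
  rw [Finset.sum_sigma', Finset.sum_sigma']
  refine Finset.sum_nbij' (fun p => ⟨p.2, p.1 - p.2⟩) (fun p => ⟨p.1 + p.2, p.1⟩) ?_ ?_ ?_ ?_ ?_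
  · rintro ⟨k, j⟩ h
    simp only [Finset.mem_sigma, Finset.mem_range, List.length_take, List.length_drop] at h ⊢
    omega
  · rintro ⟨j, i⟩ h
    simp only [Finset.mem_sigma, Finset.mem_range, List.length_take, List.length_drop] at h ⊢
    omega
  · rintro ⟨k, j⟩ h
    simp only [Finset.mem_sigma, Finset.mem_range, List.length_take] at h ⊢
    congr 1
    omega
  · rintro ⟨j, i⟩ h
    simp
  · rintro ⟨k, j⟩ h
    simp only [Finset.mem_sigma, Finset.mem_range, List.length_take] at h ⊢
    rw [List.take_take, List.drop_take, List.drop_drop, min_eq_left (by omega),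
      show j + (k - j) = k by omega]

theorem mul_assoc' (f g h : Series) : f * g * h = f * (g * h) := by
  ext S w
  have L : (f * g * h) S w =
      ∑ D ∈ S.powerset, ∑ A ∈ D.powerset,
        ∑ k ∈ Finset.range (w.length + 1), ∑ j ∈ Finset.range ((w.take k).length + 1),
          crossSign (A ∪ D \ A) (S \ D) * crossSign A (D \ A) * f A ((w.take k).take j) *
            g (D \ A) ((w.take k).drop j) * h (S \ D) (w.drop k) := by
    rw [mul_apply]
    refine Finset.sum_congr rfl fun D _ => ?_
    rw [Finset.sum_comm]
    refine Finset.sum_congr rfl fun k _ => ?_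
    rw [mul_apply, Finset.mul_sum, Finset.sum_mul]
    refine Finset.sum_congr rfl fun A hA => ?_
    rw [Finset.mul_sum, Finset.sum_mul]
    refine Finset.sum_congr rfl fun j _ => ?_
    rw [Finset.union_sdiff_of_subset (Finset.mem_powerset.1 hA)]
    ring
  have R : (f * (g * h)) S w =
      ∑ A ∈ S.powerset, ∑ B ∈ (S \ A).powerset,
        ∑ j ∈ Finset.range (w.length + 1), ∑ i ∈ Finset.range ((w.drop j).length + 1),
          crossSign A (B ∪ (S \ A) \ B) * crossSign B ((S \ A) \ B) * f A (w.take j) *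
            g B ((w.drop j).take i) * h ((S \ A) \ B) ((w.drop j).drop i) := by
    rw [mul_apply]
    refine Finset.sum_congr rfl fun A _ => ?_
    rw [Finset.sum_comm]
    refine Finset.sum_congr rfl fun j _ => ?_
    rw [mul_apply, Finset.mul_sum]
    refine Finset.sum_congr rfl fun B hB => ?_
    rw [Finset.mul_sum]
    refine Finset.sum_congr rfl fun i _ => ?_
    rw [Finset.union_sdiff_of_subset (Finset.mem_powerset.1 hB)]
    ring
  rw [L, R, sum_split_set S (fun A B C =>
    ∑ k ∈ Finset.range (w.length + 1), ∑ j ∈ Finset.range ((w.take k).length + 1),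
      crossSign (A ∪ B) C * crossSign A B * f A ((w.take k).take j) *
        g B ((w.take k).drop j) * h C (w.drop k))]
  refine Finset.sum_congr rfl fun A _ => Finset.sum_congr rfl fun B hB => ?_
  rw [sum_split_list w (fun t u v => crossSign (A ∪ B) ((S \ A) \ B) * crossSign A B * f A t *
        g B u * h ((S \ A) \ B) v)]
  have hAB : Disjoint A B :=
    Finset.disjoint_of_subset_right (Finset.mem_powerset.1 hB) Finset.disjoint_sdiff
  rw [crossSign_union_left hAB, crossSign_union_right A (Finset.disjoint_sdiff (s := B))]
  refine Finset.sum_congr rfl fun j _ => Finset.sum_congr rfl fun i _ => ?_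
  ring

theorem one_mul' (f : Series) : 1 * f = f := by
  ext S w
  rw [mul_apply, Finset.sum_eq_single ∅, Finset.sum_eq_single 0]
  · simp [one_apply, crossSign_empty_left]
  · intro k hk hk0
    have : w.take k ≠ [] := by
      intro h
      rw [List.take_eq_nil_iff] at h
      rcases h with h | h
      · exact hk0 h
      · subst h
        simp at hk
        exact hk0 hk
    simp [one_apply, this]
  · simp
  · intro A _ hA
    simp [one_apply, hA]
  · simp

theorem mul_one' (f : Series) : f * 1 = f := by
  ext S w
  rw [mul_apply, Finset.sum_eq_single S, Finset.sum_eq_single w.length]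
  · simp [one_apply, crossSign_empty_right]
  · intro k hk hk0
    have : w.drop k ≠ [] := by
      intro h
      rw [List.drop_eq_nil_iff] at h
      rw [Finset.mem_range] at hk
      omega
    simp [one_apply, this]
  · simp
  · intro A hA hAS
    have : ¬ S \ A = ∅ := fun h =>
      hAS (Finset.Subset.antisymm (Finset.mem_powerset.1 hA) (Finset.sdiff_eq_empty_iff_subset.1 h))
    simp [one_apply, this]
  · simp

instance : Ring Series :=
  { (inferInstance : AddCommGroup Series), (inferInstance : Mul Series),
    (inferInstance : One Series) with
    mul_assoc := mul_assoc'
    one_mul := one_mul'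
    mul_one := mul_one'
    left_distrib := fun f g h => by
      ext S w
      simp only [mul_apply, add_apply, mul_add, Finset.sum_add_distrib]
    right_distrib := fun f g h => by
      ext S w
      simp only [mul_apply, add_apply, mul_add, add_mul, Finset.sum_add_distrib]
    zero_mul := fun f => by
      ext S w
      simp [mul_apply]
    mul_zero := fun f => by
      ext S w
      simp [mul_apply] }

instance : Algebra ℚ Series :=
  Algebra.ofModule
    (fun c f g => by
      ext S w
      simp only [mul_apply, smul_apply, Finset.mul_sum]
      refine Finset.sum_congr rfl fun A _ => Finset.sum_congr rfl fun k _ => ?_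
      ring)
    (fun c f g => by
      ext S w
      simp only [mul_apply, smul_apply, Finset.mul_sum]
      refine Finset.sum_congr rfl fun A _ => Finset.sum_congr rfl fun k _ => ?_
      ring)

/-- The variable `x i`. -/
def x (i : ℕ) : Series := fun S w => if S = ∅ ∧ w = [i] then 1 else 0

/-- The fermionic variable `θ i`. -/
def θ (i : ℕ) : Series := fun S w => if S = {i} ∧ w = [] then 1 else 0

/-- The series of bounded degree: the total degree of the occurring monomials is bounded. -/
def boundedDegree : Subalgebra ℚ Series where
  carrier := {f | ∃ d : ℕ, ∀ S w, f S w ≠ 0 → S.card + w.length ≤ d}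
  mul_mem' := by
    rintro f g ⟨d, hd⟩ ⟨e, he⟩
    refine ⟨d + e, fun S w h => ?_⟩
    rw [mul_apply] at h
    obtain ⟨A, hA, h⟩ := Finset.exists_ne_zero_of_sum_ne_zero h
    obtain ⟨k, hk, h⟩ := Finset.exists_ne_zero_of_sum_ne_zero h
    have h1 := hd _ _ (right_ne_zero_of_mul (left_ne_zero_of_mul h))
    have h2 := he _ _ (right_ne_zero_of_mul h)
    have h3 := Finset.card_sdiff_add_card_eq_card (Finset.mem_powerset.1 hA)
    rw [Finset.mem_range] at hk
    simp only [List.length_take, List.length_drop] at h1 h2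
    omega
  add_mem' := by
    rintro f g ⟨d, hd⟩ ⟨e, he⟩
    refine ⟨d + e, fun S w h => ?_⟩
    by_cases hf : f S w = 0
    · have := he S w (by rwa [add_apply, hf, zero_add] at h)
      omega
    · have := hd S w hf
      omega
  algebraMap_mem' := by
    intro r
    refine ⟨0, fun S w h => ?_⟩
    rw [Algebra.algebraMap_eq_smul_one, smul_apply, one_apply] at h
    split_ifs at h with h0
    · simp [h0.1, h0.2]
    · simp at h

/-- The sign `ε` with `θ (σ i₁) * ⋯ * θ (σ iₘ) = ε • θ_(σ A)` for `A = {i₁ < ⋯ < iₘ}`. -/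
def permSign (σ : Equiv.Perm ℕ) (A : Finset ℕ) : ℚ :=
  ∏ a ∈ A, ∏ b ∈ A, if a < b ∧ σ b < σ a then -1 else 1

theorem permSign_union (σ : Equiv.Perm ℕ) {A B : Finset ℕ} (h : Disjoint A B) :
    permSign σ (A ∪ B) * crossSign A B =
      crossSign (A.map σ.toEmbedding) (B.map σ.toEmbedding) * (permSign σ A * permSign σ B) := by
  have key : (∏ a ∈ A, ∏ b ∈ B, (if a < b ∧ σ b < σ a then (-1 : ℚ) else 1)) *
      (∏ b ∈ B, ∏ a ∈ A, (if b < a ∧ σ a < σ b then (-1 : ℚ) else 1)) * crossSign A B =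
      crossSign (A.map σ.toEmbedding) (B.map σ.toEmbedding) := by
    rw [Finset.prod_comm (s := B)]
    simp only [crossSign, Finset.prod_map, Equiv.coe_toEmbedding]
    rw [← Finset.prod_mul_distrib, ← Finset.prod_mul_distrib]
    refine Finset.prod_congr rfl fun a ha => ?_
    rw [← Finset.prod_mul_distrib, ← Finset.prod_mul_distrib]
    refine Finset.prod_congr rfl fun b hb => ?_
    have hab : a ≠ b := fun e => Finset.disjoint_left.1 h ha (e ▸ hb)
    have hs : σ a ≠ σ b := fun e => hab (σ.injective e)
    rcases lt_or_gt_of_ne hab with h1 | h1 <;> rcases lt_or_gt_of_ne hs with h2 | h2 <;>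
      simp [h1, h2, h1.not_gt, h2.not_gt]
  rw [← key]
  simp only [permSign, Finset.prod_union h, Finset.prod_mul_distrib]
  ring

/-- The action of a permutation of the indices on series, with
`θ_A * x_w ↦ permSign σ A • (θ_(σ A) * x_(σ w))`. -/
def permFun (σ : Equiv.Perm ℕ) (f : Series) : Series := fun S w =>
  permSign σ (S.map σ.symm.toEmbedding) * f (S.map σ.symm.toEmbedding) (w.map σ.symm)

theorem permFun_apply (σ : Equiv.Perm ℕ) (f : Series) (S : Finset ℕ) (w : List ℕ) :
    permFun σ f S w =
      permSign σ (S.map σ.symm.toEmbedding) * f (S.map σ.symm.toEmbedding) (w.map σ.symm) := rfl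

theorem permFun_one (σ : Equiv.Perm ℕ) : permFun σ 1 = 1 := by
  ext S w
  simp only [permFun_apply, one_apply, Finset.map_eq_empty, List.map_eq_nil_iff]
  split_ifs with h
  · simp [h.1, permSign]
  · simp

theorem permFun_mul (σ : Equiv.Perm ℕ) (f g : Series) :
    permFun σ (f * g) = permFun σ f * permFun σ g := by
  ext S w
  simp only [permFun_apply, mul_apply, List.length_map]
  rw [Finset.mul_sum]
  refine Finset.sum_nbij' (fun A => A.map σ.toEmbedding) (fun A => A.map σ.symm.toEmbedding)
    ?_ ?_ ?_ ?_ ?_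
  · intro A hA
    rw [Finset.mem_powerset] at hA ⊢
    intro y hy
    obtain ⟨z, hz, rfl⟩ := Finset.mem_map.1 hy
    obtain ⟨t, ht, rfl⟩ := Finset.mem_map.1 (hA hz)
    simpa using ht
  · intro A hA
    rw [Finset.mem_powerset] at hA ⊢
    exact Finset.map_subset_map.2 hA
  · intro A _
    ext y
    simp
  · intro A _
    ext y
    simp
  · intro A hA
    rw [Finset.mem_powerset] at hA
    have e1 : (A.map σ.toEmbedding).map σ.symm.toEmbedding = A := by
      ext y
      simp
    have e2 : (S \ A.map σ.toEmbedding).map σ.symm.toEmbedding =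
        S.map σ.symm.toEmbedding \ A := by
      rw [Finset.map_sdiff, e1]
    have e3 : (S.map σ.symm.toEmbedding \ A).map σ.toEmbedding = S \ A.map σ.toEmbedding := by
      ext y
      simp
    rw [e1, e2, Finset.mul_sum]
    refine Finset.sum_congr rfl fun k _ => ?_
    have hs := permSign_union σ (Finset.disjoint_sdiff (s := A)
      (t := S.map σ.symm.toEmbedding))
    rw [Finset.union_sdiff_of_subset hA, e3] at hs
    rw [← List.map_take, ← List.map_drop]
    linear_combination (f A (List.map (σ.symm) (List.take k w)) *
      g (S.map σ.symm.toEmbedding \ A) (List.map (σ.symm) (List.drop k w))) * hs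

/-- The action of a permutation of the indices: the algebra morphism with `x i ↦ x (σ i)`,
`θ i ↦ θ (σ i)` that is compatible with infinite sums. -/
def permAct (σ : Equiv.Perm ℕ) : Series →ₐ[ℚ] Series :=
  AlgHom.ofLinearMap
    { toFun := permFun σ
      map_add' := fun f g => by
        ext S w
        simp only [permFun_apply, add_apply, mul_add]
      map_smul' := fun c f => by
        ext S w
        simp only [permFun_apply, smul_apply, RingHom.id_apply]
        ring }
    (permFun_one σ) (permFun_mul σ)

/-- The normal form `θ_A * x_u`. -/
def mono (A : Finset ℕ) (u : List ℕ) : Series := fun S w => if S = A ∧ w = u then 1 else 0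

theorem mono_apply (A : Finset ℕ) (u : List ℕ) (S : Finset ℕ) (w : List ℕ) :
    mono A u S w = if S = A ∧ w = u then 1 else 0 := rfl

theorem crossSign_of_not_disjoint {A B : Finset ℕ} (h : ¬ Disjoint A B) : crossSign A B = 0 := by
  obtain ⟨a, ha, hb⟩ := Finset.not_disjoint_iff.1 h
  exact Finset.prod_eq_zero ha (Finset.prod_eq_zero hb (by simp))

theorem mono_mul_mono (A B : Finset ℕ) (u v : List ℕ) :
    mono A u * mono B v = crossSign A B • mono (A ∪ B) (u ++ v) := by
  ext S w
  rw [smul_apply, mul_apply]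
  by_cases hd : Disjoint A B
  · by_cases h : S = A ∪ B ∧ w = u ++ v
    · obtain ⟨rfl, rfl⟩ := h
      have hB : (A ∪ B) \ A = B := by
        rw [Finset.union_sdiff_left]
        exact Finset.sdiff_eq_self_of_disjoint hd.symm
      rw [Finset.sum_eq_single A, Finset.sum_eq_single u.length]
      · simp [mono_apply, hB]
      · intro k hk hne
        have : ¬ (u ++ v).take k = u := by
          intro e
          have := congrArg List.length e
          rw [List.length_take] at this
          rw [Finset.mem_range] at hk
          omega
        simp [mono_apply, this]
      · intro hk
        simp only [Finset.mem_range, List.length_append] at hk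
        omega
      · intro C _ hC
        simp [mono_apply, hC]
      · intro hA
        exact absurd (Finset.mem_powerset.2 Finset.subset_union_left) hA
    · rw [mono_apply, if_neg h, mul_zero]
      refine Finset.sum_eq_zero fun C hC => Finset.sum_eq_zero fun k _ => ?_
      by_contra hne
      have h1 := right_ne_zero_of_mul (left_ne_zero_of_mul hne)
      have h2 := right_ne_zero_of_mul hne
      rw [mono_apply] at h1 h2
      simp only [ne_eq, ite_eq_right_iff, one_ne_zero, imp_false, not_not] at h1 h2
      apply h
      rw [← h1.1, ← h1.2, ← h2.1, ← h2.2, List.take_append_drop,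
        Finset.union_sdiff_of_subset (Finset.mem_powerset.1 hC)]
      exact ⟨rfl, rfl⟩
  · rw [crossSign_of_not_disjoint hd, zero_mul]
    refine Finset.sum_eq_zero fun C _ => Finset.sum_eq_zero fun k _ => ?_
    by_contra hne
    have h1 := right_ne_zero_of_mul (left_ne_zero_of_mul hne)
    have h2 := right_ne_zero_of_mul hne
    rw [mono_apply] at h1 h2
    simp only [ne_eq, ite_eq_right_iff, one_ne_zero, imp_false, not_not] at h1 h2
    apply hd
    rw [← h1.1, ← h2.1]
    exact Finset.disjoint_sdiff

theorem x_eq_mono (i : ℕ) : x i = mono ∅ [i] := rfl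

theorem θ_eq_mono (i : ℕ) : θ i = mono {i} [] := rfl

/-! The relations between the variables, and the action on them. -/

theorem x_mul_θ (i j : ℕ) : x i * θ j = θ j * x i := by
  rw [x_eq_mono, θ_eq_mono, mono_mul_mono, mono_mul_mono, crossSign_empty_left,
    crossSign_empty_right]
  simp

theorem θ_mul_θ (i j : ℕ) : θ i * θ j = -(θ j * θ i) := by
  rw [θ_eq_mono, θ_eq_mono, mono_mul_mono, mono_mul_mono, Finset.union_comm, ← neg_smul]
  congr 1
  simp only [crossSign, Finset.prod_singleton]
  rcases lt_trichotomy i j with h | h | h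
  · simp [h, h.not_gt]
  · simp [h]
  · simp [h, h.not_gt]

theorem permAct_mono (σ : Equiv.Perm ℕ) (A : Finset ℕ) (u : List ℕ) :
    permAct σ (mono A u) = permSign σ A • mono (A.map σ.toEmbedding) (u.map σ) := by
  ext S w
  change permFun σ (mono A u) S w = _
  rw [permFun_apply, smul_apply, mono_apply, mono_apply]
  have hS : S.map σ.symm.toEmbedding = A ↔ S = A.map σ.toEmbedding := by
    constructor
    · rintro rfl
      ext y
      simp
    · rintro rfl
      ext y
      simp
  have hw : w.map σ.symm = u ↔ w = u.map σ := by
    constructor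
    · rintro rfl
      simp
    · rintro rfl
      simp
  by_cases h : S = A.map σ.toEmbedding ∧ w = u.map σ
  · rw [if_pos ⟨hS.2 h.1, hw.2 h.2⟩, if_pos h, hS.2 h.1]
  · rw [if_neg (fun h' => h ⟨hS.1 h'.1, hw.1 h'.2⟩), if_neg h, mul_zero, mul_zero]

theorem permAct_x (σ : Equiv.Perm ℕ) (i : ℕ) : permAct σ (x i) = x (σ i) := by
  rw [x_eq_mono, permAct_mono]
  simp [permSign, x_eq_mono]

theorem permAct_θ (σ : Equiv.Perm ℕ) (i : ℕ) : permAct σ (θ i) = θ (σ i) := by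
  rw [θ_eq_mono, permAct_mono]
  simp [permSign, θ_eq_mono]

end Series

/-- The algebra of symmetric functions in noncommuting variables in superspace: the series of
bounded degree that are fixed by all permutations moving only finitely many indices. -/
def sNCSym : Subalgebra ℚ Series :=
  Series.boundedDegree ⊓
    ⨅ (σ : Equiv.Perm ℕ) (_ : {i | σ i ≠ i}.Finite),
      AlgHom.equalizer (Series.permAct σ) (AlgHom.id ℚ Series)

/-! ### Partial set supercompositions and set superpartitions -/

/-- Partial set supercompositions of bidegree `(n, m)`: tuples `(K_1, …, K_q)` of nonempty subsets
of `{0, …, n}` covering `{1, …, n}`, meeting pairwise at most in `0`, whose first `m` blocks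
contain `0` and whose other blocks do not contain `0` and are listed by increasing minimum.
The order of the latter blocks being forced, they are recorded as the set `nonferm`. -/
@[ext] structure SetSupercomposition (n m : ℕ) where
  /-- the fermionic blocks `K_1, …, K_m` -/
  ferm : Fin m → Finset (Fin (n + 1))
  /-- the blocks `K_{m+1}, …, K_q` -/
  nonferm : Finset (Finset (Fin (n + 1)))
  le_succ : m ≤ n + 1
  zero_mem_ferm : ∀ i, 0 ∈ ferm i
  zero_notMem : ∀ B ∈ nonferm, 0 ∉ B
  nonempty : ∀ B ∈ nonferm, B.Nonempty
  cover : ∀ k, k ≠ 0 → (∃ i, k ∈ ferm i) ∨ ∃ B ∈ nonferm, k ∈ B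
  ferm_inter : ∀ i j, i ≠ j → ferm i ∩ ferm j ⊆ {0}
  ferm_disjoint : ∀ i, ∀ B ∈ nonferm, Disjoint (ferm i) B
  nonferm_disjoint : ∀ B ∈ nonferm, ∀ C ∈ nonferm, B ≠ C → Disjoint B C

namespace SetSupercomposition

variable {n m : ℕ}

/-- The set of all blocks. -/
def blocks (K : SetSupercomposition n m) : Finset (Finset (Fin (n + 1))) :=
  Finset.univ.image K.ferm ∪ K.nonferm

/-- The underlying set partition `K⁺` of `{1, …, n}`: the nonempty sets `B \ {0}`, `B` a block. -/
def underlying (K : SetSupercomposition n m) : Finset (Finset (Fin (n + 1))) :=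
  (K.blocks.image fun B => B \ {0}).filter Finset.Nonempty

/-- `K ≤ L` if `L` is strongly coarser than `K`: the `i`th fermionic block of `L` is the `i`th
fermionic block of `K` joined with some (possibly no) nonfermionic blocks of `K`, and each
nonfermionic block of `L` is a union of nonfermionic blocks of `K`. -/
instance : LE (SetSupercomposition n m) where
  le K L :=
    (∀ i, ∃ T ⊆ K.nonferm, L.ferm i = K.ferm i ∪ T.biUnion id) ∧
      ∀ D ∈ L.nonferm, ∃ T ⊆ K.nonferm, D = T.biUnion id

theorem ferm_eq_of_mem (K : SetSupercomposition n m) {i j : Fin m} {k : Fin (n + 1)} (hk : k ≠ 0)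
    (hi : k ∈ K.ferm i) (hj : k ∈ K.ferm j) : i = j := by
  by_contra h
  exact hk (Finset.mem_singleton.1 (K.ferm_inter i j h (Finset.mem_inter.2 ⟨hi, hj⟩)))

theorem nonferm_eq_of_mem (K : SetSupercomposition n m) {B C : Finset (Fin (n + 1))}
    {k : Fin (n + 1)} (hB : B ∈ K.nonferm) (hC : C ∈ K.nonferm) (hi : k ∈ B) (hj : k ∈ C) :
    B = C := by
  by_contra h
  exact Finset.disjoint_left.1 (K.nonferm_disjoint B hB C hC h) hi hj

theorem notMem_ferm (K : SetSupercomposition n m) {B : Finset (Fin (n + 1))}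
    {k : Fin (n + 1)} (hB : B ∈ K.nonferm) (hk : k ∈ B) (i : Fin m) : k ∉ K.ferm i :=
  fun h => Finset.disjoint_left.1 (K.ferm_disjoint i B hB) h hk

theorem ne_zero_of_mem (K : SetSupercomposition n m) {B : Finset (Fin (n + 1))}
    {k : Fin (n + 1)} (hB : B ∈ K.nonferm) (hk : k ∈ B) : k ≠ 0 :=
  fun h => K.zero_notMem B hB (h ▸ hk)

theorem le_iff (K L : SetSupercomposition n m) :
    K ≤ L ↔ (∀ i, K.ferm i ⊆ L.ferm i) ∧
      ∀ B ∈ K.nonferm, (∃ i, B ⊆ L.ferm i) ∨ ∃ D ∈ L.nonferm, B ⊆ D := by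
  constructor
  · rintro ⟨h1, h2⟩
    refine ⟨fun i => ?_, fun B hB => ?_⟩
    · obtain ⟨T, -, e⟩ := h1 i
      rw [e]
      exact Finset.subset_union_left
    · obtain ⟨k, hk⟩ := K.nonempty B hB
      rcases L.cover k (K.ne_zero_of_mem hB hk) with ⟨i, hi⟩ | ⟨D, hD, hkD⟩
      · left
        refine ⟨i, ?_⟩
        obtain ⟨T, hT, e⟩ := h1 i
        rw [e] at hi ⊢
        rcases Finset.mem_union.1 hi with h | h
        · exact absurd h (K.notMem_ferm hB hk i)
        · obtain ⟨C, hC, hkC⟩ := Finset.mem_biUnion.1 h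
          rw [K.nonferm_eq_of_mem hB (hT hC) hk hkC]
          exact (Finset.subset_biUnion_of_mem id hC).trans Finset.subset_union_right
      · right
        refine ⟨D, hD, ?_⟩
        obtain ⟨T, hT, e⟩ := h2 D hD
        rw [e] at hkD ⊢
        obtain ⟨C, hC, hkC⟩ := Finset.mem_biUnion.1 hkD
        rw [K.nonferm_eq_of_mem hB (hT hC) hk hkC]
        exact Finset.subset_biUnion_of_mem id hC
  · rintro ⟨h1, h2⟩
    refine ⟨fun i => ⟨K.nonferm.filter (· ⊆ L.ferm i), Finset.filter_subset _ _, ?_⟩,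
      fun D hD => ⟨K.nonferm.filter (· ⊆ D), Finset.filter_subset _ _, ?_⟩⟩
    · ext k
      simp only [Finset.mem_union, Finset.mem_biUnion, Finset.mem_filter, id]
      constructor
      · intro hk
        by_cases hk0 : k = 0
        · subst hk0
          exact Or.inl (K.zero_mem_ferm i)
        rcases K.cover k hk0 with ⟨j, hj⟩ | ⟨B, hB, hkB⟩
        · rw [L.ferm_eq_of_mem hk0 hk (h1 j hj)]
          exact Or.inl hj
        · rcases h2 B hB with ⟨j, hj⟩ | ⟨D, hD, hBD⟩
          · rw [← L.ferm_eq_of_mem hk0 hk (hj hkB)] at hj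
            exact Or.inr ⟨B, ⟨hB, hj⟩, hkB⟩
          · exact absurd hk (L.notMem_ferm hD (hBD hkB) i)
      · rintro (hk | ⟨B, ⟨-, hB⟩, hk⟩)
        · exact h1 i hk
        · exact hB hk
    · ext k
      simp only [Finset.mem_biUnion, Finset.mem_filter, id]
      constructor
      · intro hk
        rcases K.cover k (L.ne_zero_of_mem hD hk) with ⟨j, hj⟩ | ⟨B, hB, hkB⟩
        · exact absurd (h1 j hj) (L.notMem_ferm hD hk j)
        · rcases h2 B hB with ⟨j, hj⟩ | ⟨D', hD', hBD⟩
          · exact absurd (hj hkB) (L.notMem_ferm hD hk j)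
          · rw [← L.nonferm_eq_of_mem hD hD' hk (hBD hkB)] at hBD
            exact ⟨B, ⟨hB, hBD⟩, hkB⟩
      · rintro ⟨B, ⟨-, hB⟩, hk⟩
        exact hB hk

theorem nonferm_subset_of_le_of_le {K L : SetSupercomposition n m} (h : K ≤ L) (h' : L ≤ K) :
    K.nonferm ⊆ L.nonferm := by
  intro B hB
  obtain ⟨k, hk⟩ := K.nonempty B hB
  rcases ((le_iff K L).1 h).2 B hB with ⟨i, hi⟩ | ⟨D, hD, hBD⟩
  · exact absurd (((le_iff L K).1 h').1 i (hi hk)) (K.notMem_ferm hB hk i)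
  · rcases ((le_iff L K).1 h').2 D hD with ⟨i, hi⟩ | ⟨C, hC, hDC⟩
    · exact absurd (hi (hBD hk)) (K.notMem_ferm hB hk i)
    · rw [← K.nonferm_eq_of_mem hB hC hk (hDC (hBD hk))] at hDC
      rwa [Finset.Subset.antisymm hBD hDC]

instance : PartialOrder (SetSupercomposition n m) where
  le_refl K := (le_iff K K).2 ⟨fun _ => le_rfl, fun B hB => Or.inr ⟨B, hB, le_rfl⟩⟩
  le_trans K L M h h' := by
    rw [le_iff] at h h' ⊢
    refine ⟨fun i => (h.1 i).trans (h'.1 i), fun B hB => ?_⟩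
    rcases h.2 B hB with ⟨i, hi⟩ | ⟨D, hD, hBD⟩
    · exact Or.inl ⟨i, hi.trans (h'.1 i)⟩
    · rcases h'.2 D hD with ⟨i, hi⟩ | ⟨E, hE, hDE⟩
      · exact Or.inl ⟨i, hBD.trans hi⟩
      · exact Or.inr ⟨E, hE, hBD.trans hDE⟩
  le_antisymm K L h h' := by
    apply SetSupercomposition.ext
    · funext i
      exact Finset.Subset.antisymm (((le_iff K L).1 h).1 i) (((le_iff L K).1 h').1 i)
    · exact Finset.Subset.antisymm (nonferm_subset_of_le_of_le h h')
        (nonferm_subset_of_le_of_le h' h)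

theorem sdiff_zero_eq {B : Finset (Fin (n + 1))} (h : 0 ∉ B) : B \ {0} = B :=
  Finset.sdiff_eq_self_of_disjoint (Finset.disjoint_singleton_right.2 h)

theorem mem_underlying (K : SetSupercomposition n m) (B : Finset (Fin (n + 1))) :
    B ∈ K.underlying ↔ B.Nonempty ∧ ((∃ i, B = K.ferm i \ {0}) ∨ B ∈ K.nonferm) := by
  simp only [underlying, blocks, Finset.mem_filter, Finset.mem_image, Finset.mem_union,
    Finset.mem_univ, true_and]
  rw [and_comm]
  refine and_congr_right fun _ => ?_
  constructor
  · rintro ⟨C, ⟨i, rfl⟩ | hC, rfl⟩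
    · exact Or.inl ⟨i, rfl⟩
    · right
      rwa [sdiff_zero_eq (K.zero_notMem C hC)]
  · rintro (⟨i, rfl⟩ | hB)
    · exact ⟨_, Or.inl ⟨i, rfl⟩, rfl⟩
    · exact ⟨B, Or.inr hB, sdiff_zero_eq (K.zero_notMem B hB)⟩

theorem underlying_eq_of_mem (K : SetSupercomposition n m) {B C : Finset (Fin (n + 1))}
    {k : Fin (n + 1)} (hB : B ∈ K.underlying) (hC : C ∈ K.underlying) (hi : k ∈ B) (hj : k ∈ C) :
    B = C := by
  rw [mem_underlying] at hB hC
  rcases hB.2 with ⟨i, rfl⟩ | hB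
  · rw [Finset.mem_sdiff, Finset.mem_singleton] at hi
    rcases hC.2 with ⟨j, rfl⟩ | hC
    · rw [Finset.mem_sdiff] at hj
      rw [K.ferm_eq_of_mem hi.2 hi.1 hj.1]
    · exact absurd hi.1 (K.notMem_ferm hC hj i)
  · rcases hC.2 with ⟨j, rfl⟩ | hC
    · rw [Finset.mem_sdiff] at hj
      exact absurd hj.1 (K.notMem_ferm hB hi j)
    · exact K.nonferm_eq_of_mem hB hC hi hj

theorem exists_mem_underlying (K : SetSupercomposition n m) {k : Fin (n + 1)} (hk : k ≠ 0) :
    ∃ B ∈ K.underlying, k ∈ B := by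
  rcases K.cover k hk with ⟨i, hi⟩ | ⟨B, hB, hkB⟩
  · have : k ∈ K.ferm i \ {0} := by simp [hi, hk]
    exact ⟨_, (K.mem_underlying _).2 ⟨⟨k, this⟩, Or.inl ⟨i, rfl⟩⟩, this⟩
  · exact ⟨B, (K.mem_underlying _).2 ⟨⟨k, hkB⟩, Or.inr hB⟩, hkB⟩

theorem ne_zero_of_mem_underlying (K : SetSupercomposition n m) {B : Finset (Fin (n + 1))}
    {k : Fin (n + 1)} (hB : B ∈ K.underlying) (hk : k ∈ B) : k ≠ 0 := by
  rw [mem_underlying] at hB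
  rcases hB.2 with ⟨i, rfl⟩ | hB
  · simp only [Finset.mem_sdiff, Finset.mem_singleton] at hk
    exact hk.2
  · exact K.ne_zero_of_mem hB hk

/-- The meet `K ⊓ L` for the strong coarsening order. -/
instance : Min (SetSupercomposition n m) where
  min K L :=
    let A : Finset (Fin (n + 1)) := Finset.univ.biUnion fun i => K.ferm i ∩ L.ferm i
    { ferm := fun i => K.ferm i ∩ L.ferm i
      nonferm := ((K.underlying ×ˢ L.underlying).image fun p => (p.1 ∩ p.2) \ A).filter
        Finset.Nonempty
      le_succ := K.le_succ
      zero_mem_ferm := fun i => Finset.mem_inter.2 ⟨K.zero_mem_ferm i, L.zero_mem_ferm i⟩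
      zero_notMem := by
        intro D hD h0
        obtain ⟨hD, -⟩ := Finset.mem_filter.1 hD
        obtain ⟨⟨B, C⟩, hp, rfl⟩ := Finset.mem_image.1 hD
        obtain ⟨hB, hC⟩ := Finset.mem_product.1 hp
        exact K.ne_zero_of_mem_underlying hB
          (Finset.mem_inter.1 (Finset.mem_sdiff.1 h0).1).1 rfl
      nonempty := fun B hB => (Finset.mem_filter.1 hB).2
      cover := by
        intro k hk
        by_cases hA : k ∈ A
        · obtain ⟨i, -, hi⟩ := Finset.mem_biUnion.1 hA
          exact Or.inl ⟨i, hi⟩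
        · obtain ⟨B, hB, hkB⟩ := K.exists_mem_underlying hk
          obtain ⟨C, hC, hkC⟩ := L.exists_mem_underlying hk
          have hm : k ∈ (B ∩ C) \ A :=
            Finset.mem_sdiff.2 ⟨Finset.mem_inter.2 ⟨hkB, hkC⟩, hA⟩
          exact Or.inr ⟨_, Finset.mem_filter.2 ⟨Finset.mem_image.2 ⟨(B, C),
            Finset.mem_product.2 ⟨hB, hC⟩, rfl⟩, ⟨k, hm⟩⟩, hm⟩
      ferm_inter := fun i j h k hk => by
        simp only [Finset.mem_inter] at hk
        exact K.ferm_inter i j h (Finset.mem_inter.2 ⟨hk.1.1, hk.2.1⟩)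
      ferm_disjoint := by
        intro i D hD
        obtain ⟨hD, -⟩ := Finset.mem_filter.1 hD
        obtain ⟨⟨B, C⟩, hp, rfl⟩ := Finset.mem_image.1 hD
        rw [Finset.disjoint_left]
        intro k hk hk'
        exact (Finset.mem_sdiff.1 hk').2 (Finset.mem_biUnion.2 ⟨i, Finset.mem_univ i, hk⟩)
      nonferm_disjoint := by
        intro D hD E hE hDE
        obtain ⟨hD, -⟩ := Finset.mem_filter.1 hD
        obtain ⟨⟨B, C⟩, hp, rfl⟩ := Finset.mem_image.1 hD
        obtain ⟨hE, -⟩ := Finset.mem_filter.1 hE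
        obtain ⟨⟨B', C'⟩, hp', rfl⟩ := Finset.mem_image.1 hE
        obtain ⟨hB, hC⟩ := Finset.mem_product.1 hp
        obtain ⟨hB', hC'⟩ := Finset.mem_product.1 hp'
        rw [Finset.disjoint_left]
        intro k hk hk'
        simp only [Finset.mem_sdiff, Finset.mem_inter] at hk hk' hB hC hB' hC'
        apply hDE
        simp only
        rw [K.underlying_eq_of_mem hB hB' hk.1.1 hk'.1.1,
          L.underlying_eq_of_mem hC hC' hk.1.2 hk'.1.2] }

theorem ferm_min (K L : SetSupercomposition n m) (i : Fin m) :
    (min K L).ferm i = K.ferm i ∩ L.ferm i := rfl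

theorem mem_nonferm_min (K L : SetSupercomposition n m) (D : Finset (Fin (n + 1))) :
    D ∈ (min K L).nonferm ↔ D.Nonempty ∧ ∃ B ∈ K.underlying, ∃ C ∈ L.underlying,
      D = (B ∩ C) \ Finset.univ.biUnion fun i => K.ferm i ∩ L.ferm i := by
  change D ∈ Finset.filter _ _ ↔ _
  simp only [Finset.mem_filter, Finset.mem_image, Finset.mem_product, Prod.exists]
  constructor
  · rintro ⟨⟨B, C, ⟨hB, hC⟩, e⟩, h⟩
    exact ⟨h, B, hB, C, hC, e.symm⟩
  · rintro ⟨h, B, hB, C, hC, e⟩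
    exact ⟨⟨B, C, ⟨hB, hC⟩, e.symm⟩, h⟩

theorem subset_of_mem_underlying (K : SetSupercomposition n m) {B : Finset (Fin (n + 1))}
    (hB : B ∈ K.underlying) : (∃ i, B ⊆ K.ferm i) ∨ ∃ D ∈ K.nonferm, B ⊆ D := by
  rcases ((K.mem_underlying B).1 hB).2 with ⟨i, rfl⟩ | h
  · exact Or.inl ⟨i, Finset.sdiff_subset⟩
  · exact Or.inr ⟨B, h, le_rfl⟩

theorem exists_underlying_of_le {M K : SetSupercomposition n m} (h : M ≤ K)
    {B : Finset (Fin (n + 1))} (hB : B ∈ M.nonferm) : ∃ C ∈ K.underlying, B ⊆ C := by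
  obtain ⟨k, hk⟩ := M.nonempty B hB
  rcases ((le_iff M K).1 h).2 B hB with ⟨i, hi⟩ | ⟨D, hD, hBD⟩
  · have : B ⊆ K.ferm i \ {0} := fun l hl => by
      simp [hi hl, M.ne_zero_of_mem hB hl]
    exact ⟨_, (K.mem_underlying _).2 ⟨⟨k, this hk⟩, Or.inl ⟨i, rfl⟩⟩, this⟩
  · exact ⟨D, (K.mem_underlying _).2 ⟨K.nonempty D hD, Or.inr hD⟩, hBD⟩

/-- The operation `min` above is the meet of the strong coarsening order. -/
instance : SemilatticeInf (SetSupercomposition n m) where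
  inf := min
  inf_le_left K L := by
    rw [le_iff]
    refine ⟨fun i => Finset.inter_subset_left, fun D hD => ?_⟩
    obtain ⟨-, B, hB, C, hC, rfl⟩ := (mem_nonferm_min K L D).1 hD
    have hs : (B ∩ C) \ (Finset.univ.biUnion fun i => K.ferm i ∩ L.ferm i) ⊆ B :=
      Finset.sdiff_subset.trans Finset.inter_subset_left
    rcases K.subset_of_mem_underlying hB with ⟨i, hi⟩ | ⟨E, hE, hBE⟩
    · exact Or.inl ⟨i, hs.trans hi⟩
    · exact Or.inr ⟨E, hE, hs.trans hBE⟩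
  inf_le_right K L := by
    rw [le_iff]
    refine ⟨fun i => Finset.inter_subset_right, fun D hD => ?_⟩
    obtain ⟨-, B, hB, C, hC, rfl⟩ := (mem_nonferm_min K L D).1 hD
    have hs : (B ∩ C) \ (Finset.univ.biUnion fun i => K.ferm i ∩ L.ferm i) ⊆ C :=
      Finset.sdiff_subset.trans Finset.inter_subset_right
    rcases L.subset_of_mem_underlying hC with ⟨i, hi⟩ | ⟨E, hE, hBE⟩
    · exact Or.inl ⟨i, hs.trans hi⟩
    · exact Or.inr ⟨E, hE, hs.trans hBE⟩
  le_inf M K L hK hL := by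
    rw [le_iff]
    have h1 := (le_iff M K).1 hK
    have h2 := (le_iff M L).1 hL
    refine ⟨fun i => Finset.subset_inter (h1.1 i) (h2.1 i), fun B hB => ?_⟩
    by_cases hc : ∃ i, B ⊆ K.ferm i ∧ B ⊆ L.ferm i
    · obtain ⟨i, hi, hi'⟩ := hc
      exact Or.inl ⟨i, Finset.subset_inter hi hi'⟩
    · right
      obtain ⟨C, hC, hBC⟩ := exists_underlying_of_le hK hB
      obtain ⟨D, hD, hBD⟩ := exists_underlying_of_le hL hB
      have hs : B ⊆ (C ∩ D) \ Finset.univ.biUnion fun i => K.ferm i ∩ L.ferm i := by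
        intro k hk
        refine Finset.mem_sdiff.2 ⟨Finset.mem_inter.2 ⟨hBC hk, hBD hk⟩, fun hA => hc ?_⟩
        obtain ⟨i, -, hi⟩ := Finset.mem_biUnion.1 hA
        obtain ⟨hiK, hiL⟩ := Finset.mem_inter.1 hi
        have hk0 := M.ne_zero_of_mem hB hk
        refine ⟨i, ?_, ?_⟩
        · rcases h1.2 B hB with ⟨j, hj⟩ | ⟨E, hE, hBE⟩
          · rwa [K.ferm_eq_of_mem hk0 hiK (hj hk)]
          · exact absurd hiK (K.notMem_ferm hE (hBE hk) i)
        · rcases h2.2 B hB with ⟨j, hj⟩ | ⟨E, hE, hBE⟩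
          · rwa [L.ferm_eq_of_mem hk0 hiL (hj hk)]
          · exact absurd hiL (L.notMem_ferm hE (hBE hk) i)
      obtain ⟨k, hk⟩ := M.nonempty B hB
      exact ⟨_, (mem_nonferm_min K L _).2 ⟨⟨k, hs hk⟩, C, hC, D, hD, rfl⟩, hs⟩

/-- The number of ways to sort the elements of all blocks simultaneously:
`K! = |K_1|! ⋯ |K_q|!`. -/
def factorial (K : SetSupercomposition n m) : ℕ :=
  (∏ i, (K.ferm i).card.factorial) * ∏ B ∈ K.nonferm, B.card.factorial

/-- The elements `j, k` of `{1, …, n}` (shifted to `Fin n`) lie in the same block. -/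
def SameBlock (K : SetSupercomposition n m) (j k : Fin n) : Prop :=
  ∃ B ∈ K.blocks, j.succ ∈ B ∧ k.succ ∈ B

/-- The minimum of a finite set, with `min ∅ = 0`. -/
noncomputable def minOrZero (B : Finset (Fin (n + 1))) : ℕ :=
  sInf {k | ∃ l ∈ B, (l : ℕ) = k}

/-- `K` is a set superpartition: `K_i ≠ K_j` and `min (K_i \ K_j) < min (K_j \ K_i)` for
`i < j`.  For blocks that are not both fermionic this holds automatically. -/
def IsSetSuperpartition (K : SetSupercomposition n m) : Prop :=
  ∀ i j : Fin m, i < j → K.ferm i ≠ K.ferm j ∧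
    minOrZero (K.ferm i \ K.ferm j) < minOrZero (K.ferm j \ K.ferm i)

end SetSupercomposition

/-- Set superpartitions of bidegree `(n, m)`. -/
def SetSuperpartition (n m : ℕ) : Type :=
  {K : SetSupercomposition n m // K.IsSetSuperpartition}

/-! ### Power sum, elementary and complete homogeneous functions -/

section functions

variable {n m : ℕ}

open Series

/-- The word `θ_{a_1} ⋯ θ_{a_m} x_{b_1} ⋯ x_{b_n}`. -/
def word (a : Fin m → ℕ) (b : Fin n → ℕ) : Series :=
  (List.ofFn fun i => θ (a i)).prod * (List.ofFn fun j => x (b j)).prod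

theorem finite_word_ne_zero (S : Finset ℕ) (w : List ℕ) :
    {u : (Fin m → ℕ) × (Fin n → ℕ) | word u.1 u.2 S w ≠ 0}.Finite := by
  have hx : ∀ l : List ℕ, (l.map x).prod = mono ∅ l := by
    intro l
    induction l with
    | nil => rfl
    | cons i l ih =>
      rw [List.map_cons, List.prod_cons, ih, x_eq_mono, mono_mul_mono, crossSign_empty_left]
      simp
  have hθ : ∀ l : List ℕ, ∃ (c : ℚ), (l.map θ).prod = c • mono l.toFinset [] := by
    intro l
    induction l with
    | nil => exact ⟨1, by rw [one_smul]; rfl⟩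
    | cons i l ih =>
      obtain ⟨c, hc⟩ := ih
      refine ⟨c * crossSign {i} l.toFinset, ?_⟩
      rw [List.map_cons, List.prod_cons, hc, θ_eq_mono, mul_smul_comm, mono_mul_mono, smul_smul]
      rw [List.toFinset_cons, Finset.insert_eq, List.append_nil]
  have hword : ∀ (a : Fin m → ℕ) (b : Fin n → ℕ), word a b S w ≠ 0 →
      (∀ i, a i ∈ S) ∧ List.ofFn b = w := by
    intro a b h
    obtain ⟨c, hc⟩ := hθ (List.ofFn a)
    have e : word a b = c • mono (List.ofFn a).toFinset (List.ofFn b) := by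
      have e1 : (List.ofFn fun i => θ (a i)) = (List.ofFn a).map θ := by
        rw [List.map_ofFn]; rfl
      have e2 : (List.ofFn fun i => x (b i)) = (List.ofFn b).map x := by
        rw [List.map_ofFn]; rfl
      rw [word, e1, e2, hc, hx, smul_mul_assoc, mono_mul_mono, crossSign_empty_right]
      simp
    rw [e, Series.smul_apply, mono_apply] at h
    split_ifs at h with h'
    · refine ⟨fun i => ?_, h'.2.symm⟩
      rw [h'.1]
      simp
    · simp at h
  refine Set.Finite.subset (Set.Finite.prod (Set.Finite.pi' fun _ : Fin m => S.finite_toSet)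
    (Set.Finite.preimage (f := fun b : Fin n → ℕ => List.ofFn b)
      (List.ofFn_injective.injOn) (Set.finite_singleton w))) ?_
  rintro ⟨a, b⟩ h
  exact hword a b h

/-- The formal sum `∑ c(a, b) • θ_{a_1} ⋯ θ_{a_m} x_{b_1} ⋯ x_{b_n}` over all `(a, b)`; only
finitely many terms contribute to each coefficient. -/
noncomputable def wordSum (c : (Fin m → ℕ) → (Fin n → ℕ) → ℚ) : Series := fun S w =>
  ∑ᶠ u : (Fin m → ℕ) × (Fin n → ℕ), c u.1 u.2 * word u.1 u.2 S w

open Classical in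
/-- The power sum function `p_K`. -/
noncomputable def powerSum (K : SetSupercomposition n m) : Series :=
  wordSum fun a b =>
    if (∀ i j, j.succ ∈ K.ferm i → a i = b j) ∧ (∀ j k, K.SameBlock j k → b j = b k)
    then 1 else 0

open Classical in
/-- The elementary function `e_K`. -/
noncomputable def elementary (K : SetSupercomposition n m) : Series :=
  wordSum fun a b =>
    if (∀ i j, j.succ ∈ K.ferm i → a i ≠ b j) ∧ (∀ j k, j ≠ k → K.SameBlock j k → b j ≠ b k)
    then 1 else 0

/-- `θ_{a_1} ⋯ θ_{a_m} x_{b_1} ⋯ x_{b_n}` is null-symmetric: `{a_1, …, a_m} \ {b_1, …, b_n}` has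
more than one element. -/
def NullSymmetric (a : Fin m → ℕ) (b : Fin n → ℕ) : Prop :=
  1 < (Finset.univ.image a \ Finset.univ.image b).card

/-- `θ_{a_1} ⋯ θ_{a_m} x_{b_1} ⋯ x_{b_n}` belongs to the set `M(L)` of the monomials of the monomial
function of `L`. -/
def MemM (L : SetSupercomposition n m) (a : Fin m → ℕ) (b : Fin n → ℕ) : Prop :=
  (∀ i j, a i = b j ↔ j.succ ∈ L.ferm i) ∧ ∀ j k, b j = b k ↔ L.SameBlock j k

open Classical in
/-- The complete homogeneous function `h_K`: the sum of `(K ⊓ L)! • u` over all monomials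
`u = θ_{a_1} ⋯ θ_{a_m} x_{b_1} ⋯ x_{b_n}` (with distinct `a_i`) that are not null-symmetric, `L`
being the unique partial set supercomposition with `u ∈ M(L)`. -/
noncomputable def completeHomogeneous (K : SetSupercomposition n m) : Series :=
  wordSum fun a b =>
    if h : Function.Injective a ∧ ¬ NullSymmetric a b ∧ ∃ L : SetSupercomposition n m, MemM L a b
    then ((K ⊓ h.2.2.choose).factorial : ℚ) else 0

end functions

end Superspace

namespace Superspace

/-! A word has a normal form up to sign, and a symmetric series has equal coefficients at words with
the same pattern of equal indices. Such a pattern is an equivalence relation on the `m + n`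
positions, the θ-positions pairwise unrelated unless the word vanishes. Permuting the θ's only
changes a sign, and if two θ-indices do not occur among the x's, transposing them shows that the
coefficient is zero. The remaining patterns, with their θ's sorted by the first x of the same index,
are exactly the set superpartitions. So the coefficients at one word per superpartition determine a
symmetric series (`coeffs_injective`); bounded degree leaves only finitely many nonzero ones.

For power sums, `p_I` has a nonzero coefficient at `J` only if, after a permutation of the θ's, the
pattern of `J` is coarser than that of `I`; the coefficient at `I` is one. The number of related
pairs (`relCard`) measures coarseness and is unaffected by such permutations, so the family is
triangular and `exists_basis_of_triangular` applies.

For `e` and `h`, fix a linear order on the positions and expand the product over `k` of the sums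
over `j ≤ k` in the block of `k` of `±[c j = c k]`, with sign `+` for `j = k`. The choices of one
`j` for each `k` are maps generating relations finer than `K`, and each term says that `c` is
constant on the classes of such a relation (`exists_prod_expansion`). With the minus sign off the
diagonal the product is the indicator of injectivity on blocks, which gives `e_K`; with the plus
sign it is the product of factorials that gives `h_K`. The relation `K` itself receives a nonzero
weight, because all maps generating it have the same fixed points, the minima of its classes, and so
contribute with equal sign. A sum over a finer relation is zero or a multiple of a power sum of
equal coarseness (`constSum_eq_zero_or`), so `e` and `h` are triangular over `p`
(`exists_basis_of_expansion`). -/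

/-! ### Linear algebra of triangular families -/

/-- A family that is triangular with respect to injective coordinates is a basis. -/
theorem exists_basis_of_triangular {ι V : Type*} [AddCommGroup V] [Module ℚ V]
    (Φ : V →ₗ[ℚ] ι →₀ ℚ) (hΦ : Function.Injective Φ) (rank : ι → ℕ) (v : ι → V)
    (hdiag : ∀ i, Φ (v i) i ≠ 0)
    (htri : ∀ i j, Φ (v i) j ≠ 0 → j = i ∨ rank j < rank i) :
    ∃ b : Module.Basis ι ℚ V, ∀ i, b i = v i := by
  have hli : LinearIndependent ℚ v := by
    rw [linearIndependent_iff]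
    intro l hl
    by_contra hne
    -- At an index of maximal rank in the relation, triangularity leaves only the diagonal
    -- contribution.
    obtain ⟨i, hi, hmax⟩ := l.support.exists_max_image rank (Finsupp.support_nonempty_iff.2 hne)
    have h1 : Φ (Finsupp.linearCombination ℚ v l) i = 0 := by rw [hl]; simp
    rw [Finsupp.linearCombination_apply, Finsupp.sum, map_sum, Finsupp.finsetSum_apply,
      Finset.sum_eq_single i] at h1
    · rw [map_smul, Finsupp.smul_apply, smul_eq_mul] at h1
      exact (mul_ne_zero (Finsupp.mem_support_iff.1 hi) (hdiag i)) h1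
    · intro j hj hji
      rw [map_smul, Finsupp.smul_apply, smul_eq_mul]
      by_contra h
      rcases htri j i (right_ne_zero_of_mul h) with h | h
      · exact hji h.symm
      · exact absurd (hmax j hj) (not_le.2 h)
    · exact fun h => absurd hi h
  -- By induction on the rank: off the diagonal, `Φ (v i)` involves only unit vectors of smaller
  -- rank. Hence the span of `v` already maps onto all of `ι →₀ ℚ`, and injectivity of `Φ` makes it
  -- everything.
  have hsingle : ∀ r i, rank i = r →
      Finsupp.single i (1 : ℚ) ∈ (Submodule.span ℚ (Set.range v)).map Φ := by
    intro r
    induction r using Nat.strong_induction_on with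
    | _ r ih =>
      intro i hi
      classical
      have h1 : Φ (v i) ∈ (Submodule.span ℚ (Set.range v)).map Φ :=
        Submodule.mem_map_of_mem (Submodule.subset_span ⟨i, rfl⟩)
      have h2 : (Φ (v i)).erase i ∈ (Submodule.span ℚ (Set.range v)).map Φ := by
        rw [← Finsupp.sum_single ((Φ (v i)).erase i)]
        refine Submodule.sum_mem _ fun j hj => ?_
        rw [Finsupp.support_erase, Finset.mem_erase, Finsupp.mem_support_iff] at hj
        rw [← Finsupp.smul_single_one]
        refine Submodule.smul_mem _ _ (ih (rank j) ?_ j rfl)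
        rcases htri i j hj.2 with h | h
        · exact absurd h hj.1
        · exact hi ▸ h
      have h3 : Finsupp.single i (1 : ℚ) =
          (Φ (v i) i)⁻¹ • (Φ (v i) - (Φ (v i)).erase i) := by
        rw [sub_eq_of_eq_add (Finsupp.single_add_erase i (Φ (v i))).symm, Finsupp.smul_single,
          smul_eq_mul, inv_mul_cancel₀ (hdiag i)]
      rw [h3]
      exact Submodule.smul_mem _ _ (Submodule.sub_mem _ h1 h2)
  have hspan : ⊤ ≤ Submodule.span ℚ (Set.range v) := by
    intro x _
    have hx : Φ x ∈ (Submodule.span ℚ (Set.range v)).map Φ := by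
      rw [← Finsupp.sum_single (Φ x)]
      refine Submodule.sum_mem _ fun j _ => ?_
      rw [← Finsupp.smul_single_one]
      exact Submodule.smul_mem _ _ (hsingle _ j rfl)
    obtain ⟨y, hy, e⟩ := hx
    exact hΦ e ▸ hy
  exact ⟨Module.Basis.mk hli hspan, fun i => by simp⟩

open Series

variable {n m : ℕ}

/-! ### Words, their normal forms and signs -/

/-- The sign `ε` with `θ_{a_1} ⋯ θ_{a_m} = ε • θ_S`, `S = {a_1, …, a_m}`. -/
def seqSign (a : Fin m → ℕ) : ℚ :=
  ∏ i, ∏ j ∈ Finset.Ioi i, if a i < a j then 1 else if a j < a i then -1 else 0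

theorem seqSign_succ (a : Fin (m + 1) → ℕ) :
    seqSign a = (∏ j : Fin m, if a 0 < a j.succ then 1 else if a j.succ < a 0 then -1 else 0) *
      seqSign fun j => a j.succ := by
  simp only [seqSign]
  rw [Fin.prod_univ_succ, Fin.prod_Ioi_zero]
  congr 1
  exact Finset.prod_congr rfl fun i _ => Fin.prod_Ioi_succ _ i

theorem seqSign_eq_zero {a : Fin m → ℕ} (h : ¬ Function.Injective a) : seqSign a = 0 := by
  simp only [Function.Injective, not_forall] at h
  obtain ⟨i, j, hij, hne⟩ := h
  wlog hlt : i < j generalizing i j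
  · exact this j i hij.symm (Ne.symm hne) (lt_of_le_of_ne (not_lt.1 hlt) (Ne.symm hne))
  exact Finset.prod_eq_zero (Finset.mem_univ i)
    (Finset.prod_eq_zero (Finset.mem_Ioi.2 hlt) (by simp [hij]))

theorem seqSign_mul_self {a : Fin m → ℕ} (h : Function.Injective a) :
    seqSign a * seqSign a = 1 := by
  simp only [seqSign, ← Finset.prod_mul_distrib]
  refine Finset.prod_eq_one fun i _ => Finset.prod_eq_one fun j hj => ?_
  rcases lt_or_gt_of_ne (h.ne (Finset.mem_Ioi.1 hj).ne) with h | h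
  · simp [h]
  · simp [h, h.not_gt]

/-- The factor at `(i, j)` is antisymmetric, so reordering the product over pairs produces the sign
of `τ`. With a repeated value both sides vanish. -/
theorem seqSign_comp (a : Fin m → ℕ) (τ : Equiv.Perm (Fin m)) :
    seqSign (a ∘ τ) = (Equiv.Perm.sign τ : ℤ) * seqSign a := by
  by_cases h : Function.Injective a
  · refine τ.prod_Ioi_comp_eq_sign_mul_prod
      (f := fun i j => if a i < a j then (1 : ℚ) else if a j < a i then -1 else 0) ?_
    intro i j
    rcases lt_trichotomy (a i) (a j) with h | h | h
    · simp [h, h.not_gt]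
    · simp [h]
    · simp [h, h.not_gt]
  · rw [seqSign_eq_zero h, seqSign_eq_zero, mul_zero]
    rwa [Function.Injective.of_comp_iff' a τ.bijective]

theorem prod_ofFn_x (b : Fin n → ℕ) :
    (List.ofFn fun j => x (b j)).prod = mono ∅ (List.ofFn b) := by
  induction n with
  | zero => rfl
  | succ n ih =>
    rw [List.ofFn_succ, List.prod_cons, ih, x_eq_mono, mono_mul_mono, crossSign_empty_left]
    simp

theorem prod_ofFn_θ (a : Fin m → ℕ) :
    (List.ofFn fun i => θ (a i)).prod = seqSign a • mono (Finset.univ.image a) [] := by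
  induction m with
  | zero => simp [seqSign]; rfl
  | succ m ih =>
    rw [List.ofFn_succ, List.prod_cons, ih, θ_eq_mono, mul_smul_comm, mono_mul_mono, smul_smul,
      seqSign_succ]
    have e : Finset.univ.image a = {a 0} ∪ Finset.univ.image fun i : Fin m => a i.succ := by
      ext y
      simp [Fin.exists_fin_succ, eq_comm]
    rw [e, List.append_nil]
    congr 1
    -- The product over the image equals the product over the indices only without repetitions; with
    -- a repetition in the tail, `seqSign` kills both sides.
    by_cases h : Function.Injective fun i : Fin m => a i.succ
    · rw [crossSign, Finset.prod_singleton, Finset.prod_image h.injOn, mul_comm]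
    · rw [seqSign_eq_zero h]
      simp

theorem word_eq (a : Fin m → ℕ) (b : Fin n → ℕ) :
    word a b = seqSign a • mono (Finset.univ.image a) (List.ofFn b) := by
  rw [word, prod_ofFn_x, prod_ofFn_θ, smul_mul_assoc, mono_mul_mono, crossSign_empty_right]
  simp

theorem word_apply (a : Fin m → ℕ) (b : Fin n → ℕ) (S : Finset ℕ) (w : List ℕ) :
    word a b S w =
      seqSign a * if S = Finset.univ.image a ∧ w = List.ofFn b then 1 else 0 := by
  rw [word_eq]; rfl

theorem word_apply_self (a : Fin m → ℕ) (b : Fin n → ℕ) :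
    word a b (Finset.univ.image a) (List.ofFn b) = seqSign a := by
  rw [word_apply]; simp

theorem of_word_ne_zero {a : Fin m → ℕ} {b : Fin n → ℕ} {S : Finset ℕ} {w : List ℕ}
    (h : word a b S w ≠ 0) :
    Function.Injective a ∧ S = Finset.univ.image a ∧ w = List.ofFn b := by
  rw [word_apply] at h
  refine ⟨?_, ?_⟩
  · by_contra ha
    exact h (by rw [seqSign_eq_zero ha, zero_mul])
  · by_contra hS
    exact h (by rw [if_neg hS, mul_zero])

theorem image_comp_perm (a : Fin m → ℕ) (τ : Equiv.Perm (Fin m)) :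
    Finset.univ.image (a ∘ τ) = Finset.univ.image a := by
  ext y
  simp only [Finset.mem_image, Finset.mem_univ, true_and, Function.comp]
  exact τ.exists_congr_left.trans (by simp)

theorem word_comp (a : Fin m → ℕ) (b : Fin n → ℕ) (τ : Equiv.Perm (Fin m)) (S : Finset ℕ)
    (w : List ℕ) : word (a ∘ τ) b S w = (Equiv.Perm.sign τ : ℤ) * word a b S w := by
  rw [word_apply, word_apply, seqSign_comp, image_comp_perm, mul_assoc]

theorem permAct_word (σ : Equiv.Perm ℕ) (a : Fin m → ℕ) (b : Fin n → ℕ) :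
    permAct σ (word a b) = word (σ ∘ a) (σ ∘ b) := by
  simp only [word, map_mul, map_list_prod, List.map_ofFn]
  congr 3 <;> · funext i; simp [permAct_θ, permAct_x]

theorem permFun_word (σ : Equiv.Perm ℕ) (a : Fin m → ℕ) (b : Fin n → ℕ) :
    permFun σ (word a b) = word (σ ∘ a) (σ ∘ b) := permAct_word σ a b

/-! ### Sums over words -/

theorem finite_support_mul_word (c : (Fin m → ℕ) → (Fin n → ℕ) → ℚ) (S : Finset ℕ) (w : List ℕ) :
    (Function.support fun u : (Fin m → ℕ) × (Fin n → ℕ) =>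
      c u.1 u.2 * word u.1 u.2 S w).Finite :=
  (finite_word_ne_zero S w).subset fun _ hu => right_ne_zero_of_mul hu

theorem wordSum_apply (c : (Fin m → ℕ) → (Fin n → ℕ) → ℚ) (S : Finset ℕ) (w : List ℕ) :
    wordSum c S w = ∑ᶠ u : (Fin m → ℕ) × (Fin n → ℕ), c u.1 u.2 * word u.1 u.2 S w := rfl

theorem wordSum_smul (r : ℚ) (c : (Fin m → ℕ) → (Fin n → ℕ) → ℚ) :
    wordSum (fun a b => r * c a b) = r • wordSum c := by
  ext S w
  rw [smul_apply, wordSum_apply, wordSum_apply, mul_finsum]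
  exact finsum_congr fun u => mul_assoc _ _ _

theorem wordSum_sum {α : Type*} (F : Finset α) (c : α → (Fin m → ℕ) → (Fin n → ℕ) → ℚ) :
    wordSum (fun a b => ∑ f ∈ F, c f a b) = ∑ f ∈ F, wordSum (c f) := by
  have happ : ∀ (g : α → Series) (S : Finset ℕ) (w : List ℕ),
      (∑ f ∈ F, g f) S w = ∑ f ∈ F, g f S w := by
    intro g S w
    classical
    induction F using Finset.induction_on with
    | empty => rfl
    | insert i F hi ih => rw [Finset.sum_insert hi, Finset.sum_insert hi, add_apply, ih]
  ext S w
  rw [happ, wordSum_apply]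
  simp only [wordSum_apply]
  rw [← finsum_sum_comm F _ fun f _ => finite_support_mul_word (c f) S w]
  exact finsum_congr fun u => Finset.sum_mul _ _ _

theorem permAct_wordSum (σ : Equiv.Perm ℕ) (c : (Fin m → ℕ) → (Fin n → ℕ) → ℚ)
    (hc : ∀ a b, c (σ ∘ a) (σ ∘ b) = c a b) : permAct σ (wordSum c) = wordSum c := by
  ext S w
  change permFun σ (wordSum c) S w = _
  rw [permFun_apply, wordSum_apply, wordSum_apply,
    mul_finsum]
  rw [← finsum_comp_equiv (Equiv.prodCongr (Equiv.arrowCongr (Equiv.refl (Fin m)) σ)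
    (Equiv.arrowCongr (Equiv.refl (Fin n)) σ))
    (f := fun u => c u.1 u.2 * word u.1 u.2 S w)]
  refine finsum_congr fun u => ?_
  -- The action on a word is known because it is an algebra morphism; comparing coefficients gives
  -- the sign needed here without computing it.
  have h := congrFun (congrFun (permFun_word σ u.1 u.2) S) w
  rw [permFun_apply] at h
  change _ = c (σ ∘ u.1) (σ ∘ u.2) * word (σ ∘ u.1) (σ ∘ u.2) S w
  rw [hc, ← h]
  ring

/-- Substitute `a ∘ τ⁻¹` for `a`; the word then changes by the sign of `τ`. -/
theorem wordSum_comp_perm (c : (Fin m → ℕ) → (Fin n → ℕ) → ℚ) (τ : Equiv.Perm (Fin m)) :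
    wordSum (fun a b => c (a ∘ τ) b) = ((Equiv.Perm.sign τ : ℤ) : ℚ) • wordSum c := by
  ext S w
  rw [smul_apply, wordSum_apply, wordSum_apply, mul_finsum]
  rw [← finsum_comp_equiv (Equiv.prodCongr (Equiv.arrowCongr τ (Equiv.refl ℕ))
    (Equiv.refl (Fin n → ℕ)))]
  refine finsum_congr fun u => ?_
  change c ((u.1 ∘ τ.symm) ∘ τ) u.2 * word (u.1 ∘ τ.symm) u.2 S w = _
  have e : (u.1 ∘ τ.symm) ∘ τ = u.1 := by funext i; simp
  rw [word_comp, e, ← Equiv.Perm.inv_def, Equiv.Perm.sign_inv]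
  ring

theorem wordSum_ne_zero {c : (Fin m → ℕ) → (Fin n → ℕ) → ℚ} {S : Finset ℕ} {w : List ℕ}
    (h : wordSum c S w ≠ 0) : S.card = m ∧ w.length = n := by
  obtain ⟨u, hu⟩ : ∃ u : (Fin m → ℕ) × (Fin n → ℕ), c u.1 u.2 * word u.1 u.2 S w ≠ 0 := by
    by_contra! h0
    exact h (finsum_eq_zero_of_forall_eq_zero h0)
  obtain ⟨ha, rfl, rfl⟩ := of_word_ne_zero (right_ne_zero_of_mul hu)
  rw [Finset.card_image_of_injective _ ha]
  simp

theorem mem_sNCSym {f : Series} : f ∈ sNCSym ↔ (∃ d : ℕ, ∀ S w, f S w ≠ 0 → S.card + w.length ≤ d) ∧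
    ∀ σ : Equiv.Perm ℕ, {i | σ i ≠ i}.Finite → permAct σ f = f := by
  rw [sNCSym, Algebra.mem_inf]
  refine and_congr Iff.rfl ?_
  simp only [Algebra.mem_iInf, AlgHom.mem_equalizer, AlgHom.id_apply]

theorem wordSum_mem {c : (Fin m → ℕ) → (Fin n → ℕ) → ℚ}
    (hc : ∀ (σ : Equiv.Perm ℕ) a b, c (σ ∘ a) (σ ∘ b) = c a b) : wordSum c ∈ sNCSym := by
  refine mem_sNCSym.2 ⟨⟨m + n, fun S w h => ?_⟩, fun σ _ => permAct_wordSum σ c (hc σ)⟩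
  obtain ⟨h1, h2⟩ := wordSum_ne_zero h
  omega

/-! ### Coefficients of symmetric series -/

/-- The coefficient of a series at the word `θ_{a_1} ⋯ θ_{a_m} x_{b_1} ⋯ x_{b_n}` (zero if the
`a_i` are not distinct). -/
def wordCoeff (a : Fin m → ℕ) (b : Fin n → ℕ) : Series →ₗ[ℚ] ℚ where
  toFun f := seqSign a * f (Finset.univ.image a) (List.ofFn b)
  map_add' f g := by rw [add_apply, mul_add]
  map_smul' r f := by rw [smul_apply, RingHom.id_apply, smul_eq_mul]; ring

theorem wordCoeff_apply (a : Fin m → ℕ) (b : Fin n → ℕ) (f : Series) :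
    wordCoeff a b f = seqSign a * f (Finset.univ.image a) (List.ofFn b) := rfl

theorem wordCoeff_comp (a : Fin m → ℕ) (b : Fin n → ℕ) (τ : Equiv.Perm (Fin m)) (f : Series) :
    wordCoeff (a ∘ τ) b f = (Equiv.Perm.sign τ : ℤ) * wordCoeff a b f := by
  rw [wordCoeff_apply, wordCoeff_apply, seqSign_comp, image_comp_perm, mul_assoc]

theorem permSign_mul_self (σ : Equiv.Perm ℕ) (A : Finset ℕ) : permSign σ A * permSign σ A = 1 := by
  simp only [permSign, ← Finset.prod_mul_distrib]
  refine Finset.prod_eq_one fun i _ => Finset.prod_eq_one fun j _ => ?_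
  split_ifs <;> norm_num

theorem permFun_apply_image (σ : Equiv.Perm ℕ) (f : Series) (a : Fin m → ℕ) (b : Fin n → ℕ) :
    permFun σ f (Finset.univ.image (σ ∘ a)) (List.ofFn (σ ∘ b)) =
      permSign σ (Finset.univ.image a) * f (Finset.univ.image a) (List.ofFn b) := by
  have h1 : (Finset.univ.image (σ ∘ a)).map σ.symm.toEmbedding = Finset.univ.image a := by
    ext y
    simp
  have h2 : (List.ofFn (σ ∘ b)).map σ.symm = List.ofFn b := by
    rw [List.map_ofFn]
    congr 1
    funext j
    simp
  rw [permFun_apply, h1, h2]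

theorem wordCoeff_perm {f : Series} (hf : f ∈ sNCSym) {σ : Equiv.Perm ℕ}
    (hσ : {i | σ i ≠ i}.Finite) (a : Fin m → ℕ) (b : Fin n → ℕ) :
    wordCoeff (σ ∘ a) (σ ∘ b) f = wordCoeff a b f := by
  have h1 : permFun σ f = f := (mem_sNCSym.1 hf).2 σ hσ
  have h2 := permFun_apply_image σ f a b
  -- Applied to the word itself, this says that the sign of `σ ∘ a` is that of `a` times `permSign`.
  have h3 := permFun_apply_image σ (word a b) a b
  rw [permFun_word, word_apply_self, word_apply_self] at h3
  rw [h1] at h2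
  rw [wordCoeff_apply, wordCoeff_apply, h2, h3]
  linear_combination (seqSign a * f (Finset.univ.image a) (List.ofFn b)) *
    permSign_mul_self σ (Finset.univ.image a)

/-- Equal kernels give a bijection between the two finite images. It extends to a permutation of
their union `T`, and by the identity outside `T`. -/
theorem exists_perm_comp_eq {X : Type*} [Fintype X] (c c' : X → ℕ)
    (h : ∀ x y, c x = c y ↔ c' x = c' y) :
    ∃ σ : Equiv.Perm ℕ, {i | σ i ≠ i}.Finite ∧ ∀ x, σ (c x) = c' x := by
  classical
  let T : Finset ℕ := Finset.univ.image c ∪ Finset.univ.image c'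
  -- The value 0 off the image of `c` is a dummy: the extension is only required to agree with `f`
  -- on that image.
  let f : T → ℕ := fun t => if ht : ∃ x, c x = t then c' ht.choose else 0
  have hf : ∀ x (hx : c x ∈ T), f ⟨c x, hx⟩ = c' x := by
    intro x hx
    have ht : ∃ y, c y = c x := ⟨x, rfl⟩
    change (if ht : ∃ y, c y = c x then c' ht.choose else 0) = c' x
    rw [dif_pos ht]
    exact (h _ _).1 ht.choose_spec
  obtain ⟨g, hg⟩ := Finset.exists_equiv_extend_of_card_eq (α := T) (t := T) (by simp)
    (s := Finset.univ.filter fun t => ∃ x, c x = t) (f := f)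
    (by
      intro y hy
      simp only [Finset.mem_image, Finset.mem_filter, Finset.mem_univ, true_and] at hy
      obtain ⟨⟨t, ht⟩, ⟨x, rfl⟩, rfl⟩ := hy
      rw [hf]
      exact Finset.mem_union_right _ (Finset.mem_image_of_mem _ (Finset.mem_univ _)))
    (by
      rintro ⟨t, ht⟩ hx ⟨u, hu⟩ hy e
      simp only [Finset.coe_filter, Finset.mem_univ, true_and, Set.mem_ofPred_eq] at hx hy
      obtain ⟨x, rfl⟩ := hx
      obtain ⟨y, rfl⟩ := hy
      rw [hf, hf] at e
      exact Subtype.ext ((h x y).2 e))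
  refine ⟨Equiv.Perm.ofSubtype g, T.finite_toSet.subset fun i hi => ?_, fun x => ?_⟩
  · by_contra hT
    exact hi (Equiv.Perm.ofSubtype_apply_of_not_mem g hT)
  · have hx : c x ∈ T := Finset.mem_union_left _ (Finset.mem_image_of_mem _ (Finset.mem_univ _))
    rw [Equiv.Perm.ofSubtype_apply_of_mem g hx, hg _ (by simp), hf]

theorem wordCoeff_eq_of_ker {f : Series} (hf : f ∈ sNCSym) {a a' : Fin m → ℕ} {b b' : Fin n → ℕ}
    (h : ∀ x y, Sum.elim a b x = Sum.elim a b y ↔ Sum.elim a' b' x = Sum.elim a' b' y) :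
    wordCoeff a b f = wordCoeff a' b' f := by
  obtain ⟨σ, hσ, e⟩ := exists_perm_comp_eq _ _ h
  have ea : σ ∘ a = a' := funext fun i => e (Sum.inl i)
  have eb : σ ∘ b = b' := funext fun j => e (Sum.inr j)
  rw [← wordCoeff_perm hf hσ a b, ea, eb]

/-- Transposing the two values leaves the x's alone and exchanges two θ's, so the coefficient equals
its own negative. -/
theorem wordCoeff_eq_zero_of_isolated {f : Series} (hf : f ∈ sNCSym) {a : Fin m → ℕ}
    {b : Fin n → ℕ} {i j : Fin m} (hij : i ≠ j) (hi : ∀ k, b k ≠ a i) (hj : ∀ k, b k ≠ a j) :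
    wordCoeff a b f = 0 := by
  by_cases ha : Function.Injective a
  · have h := wordCoeff_perm hf (σ := Equiv.swap (a i) (a j)) ((Set.toFinite {a i, a j}).subset
      fun k hk => by
        by_contra h
        simp only [Set.mem_insert_iff, Set.mem_singleton_iff, not_or] at h
        exact hk (Equiv.swap_apply_of_ne_of_ne h.1 h.2)) a b
    have e1 : Equiv.swap (a i) (a j) ∘ a = a ∘ Equiv.swap i j := by
      funext k
      exact ha.swap_apply i j k
    have e2 : Equiv.swap (a i) (a j) ∘ b = b := by
      funext k
      exact Equiv.swap_apply_of_ne_of_ne (hi k) (hj k)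
    rw [e1, e2, wordCoeff_comp, Equiv.Perm.sign_swap hij] at h
    simp only [Units.val_neg, Units.val_one, Int.cast_neg, Int.cast_one] at h
    linarith
  · rw [wordCoeff_apply, seqSign_eq_zero ha, zero_mul]

/-- The words with the normal form of `(a, b)` up to sign are exactly those of `(a ∘ τ, b)`, each
with the relative sign of `τ`. -/
theorem wordCoeff_wordSum {a : Fin m → ℕ} (ha : Function.Injective a) (b : Fin n → ℕ)
    (c : (Fin m → ℕ) → (Fin n → ℕ) → ℚ) :
    wordCoeff a b (wordSum c) =
      ∑ τ : Equiv.Perm (Fin m), ((Equiv.Perm.sign τ : ℤ) : ℚ) * c (a ∘ τ) b := by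
  classical
  let g : Equiv.Perm (Fin m) → (Fin m → ℕ) × (Fin n → ℕ) := fun τ => (a ∘ τ, b)
  have hg : Function.Injective g := fun τ τ' e => by
    ext i
    have := congrFun (congrArg Prod.fst e) i
    exact congrArg Fin.val (ha this)
  rw [wordCoeff_apply, wordSum_apply, finsum_eq_sum_of_support_subset (s := Finset.univ.image g),
    Finset.sum_image hg.injOn, Finset.mul_sum]
  · refine Finset.sum_congr rfl fun τ _ => ?_
    change seqSign a * (c (a ∘ τ) b * word (a ∘ τ) b _ _) = _
    rw [word_comp, word_apply_self]
    linear_combination (((Equiv.Perm.sign τ : ℤ) : ℚ) * c (a ∘ τ) b) * seqSign_mul_self ha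
  · rintro ⟨a', b'⟩ hu
    obtain ⟨ha', hS, hw⟩ := of_word_ne_zero (right_ne_zero_of_mul hu)
    have hb : b = b' := List.ofFn_injective hw
    have hex : ∀ i, ∃ k, a k = a' i := fun i => by
      have : a' i ∈ Finset.univ.image a := by rw [hS]; simp
      simpa using this
    choose t ht using hex
    have htinj : Function.Injective t := fun i j e =>
      ha' ((ht i).symm.trans ((congrArg a e).trans (ht j)))
    rw [Finset.mem_coe, Finset.mem_image]
    refine ⟨Equiv.ofBijective t (Finite.injective_iff_bijective.1 htinj), Finset.mem_univ _, ?_⟩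
    exact Prod.ext (funext fun i => ht i) hb

theorem exists_word_eq (S : Finset ℕ) (w : List ℕ) :
    ∃ (a : Fin S.card → ℕ) (b : Fin w.length → ℕ), Function.Injective a ∧
      Finset.univ.image a = S ∧ List.ofFn b = w :=
  ⟨S.orderEmbOfFin rfl, w.get, (S.orderEmbOfFin rfl).injective,
    by simp, List.ofFn_get w⟩

theorem apply_eq_zero_of_wordCoeff {f : Series} {a : Fin m → ℕ} (ha : Function.Injective a)
    {b : Fin n → ℕ} (h : wordCoeff a b f = 0) : f (Finset.univ.image a) (List.ofFn b) = 0 := by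
  rw [wordCoeff_apply] at h
  refine (mul_eq_zero.1 h).resolve_left fun h0 => ?_
  have := seqSign_mul_self ha
  rw [h0] at this
  simp at this

theorem exists_isolated_of_nullSymmetric {a : Fin m → ℕ} {b : Fin n → ℕ}
    (h : NullSymmetric a b) : ∃ i j, i ≠ j ∧ (∀ k, b k ≠ a i) ∧ ∀ k, b k ≠ a j := by
  obtain ⟨p, hp, q, hq, hpq⟩ := Finset.one_lt_card.1 h
  simp only [Finset.mem_sdiff, Finset.mem_image, Finset.mem_univ, true_and, not_exists] at hp hq
  obtain ⟨⟨i, rfl⟩, hi⟩ := hp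
  obtain ⟨⟨j, rfl⟩, hj⟩ := hq
  exact ⟨i, j, fun e => hpq (by rw [e]), hi, hj⟩

theorem apply_eq_zero_of_nullSymmetric {f : Series} (hf : f ∈ sNCSym) {a : Fin m → ℕ}
    (ha : Function.Injective a) {b : Fin n → ℕ} (h : NullSymmetric a b) :
    f (Finset.univ.image a) (List.ofFn b) = 0 := by
  obtain ⟨i, j, hij, hi, hj⟩ := exists_isolated_of_nullSymmetric h
  exact apply_eq_zero_of_wordCoeff ha (wordCoeff_eq_zero_of_isolated hf hij hi hj)

theorem nullSymmetric_of_isolated {a : Fin m → ℕ} (ha : Function.Injective a)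
    {b : Fin n → ℕ} {i j : Fin m} (hij : i ≠ j) (hi : ∀ k, b k ≠ a i) (hj : ∀ k, b k ≠ a j) :
    NullSymmetric a b :=
  Finset.one_lt_card.2 ⟨a i, by simpa using hi, a j, by simpa using hj, ha.ne hij⟩

/-! ### Supercompositions as equivalence relations on positions -/

namespace SetSupercomposition

open Classical in
/-- The block of `K` containing `0` of the `i`th fermionic block, respectively `j + 1`. -/
noncomputable def blockOf (K : SetSupercomposition n m) :
    Fin m ⊕ Fin n → Fin m ⊕ Finset (Fin (n + 1))
  | .inl i => .inl i
  | .inr j => if h : ∃ i, j.succ ∈ K.ferm i then .inl h.choose else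
      .inr ((K.nonferm.filter fun B => j.succ ∈ B).biUnion id)

theorem blockOf_inr_of_mem_ferm (K : SetSupercomposition n m) {i : Fin m} {j : Fin n}
    (h : j.succ ∈ K.ferm i) : K.blockOf (.inr j) = .inl i := by
  have h' : ∃ i, j.succ ∈ K.ferm i := ⟨i, h⟩
  rw [blockOf, dif_pos h', K.ferm_eq_of_mem (Fin.succ_ne_zero j) h'.choose_spec h]

theorem blockOf_inr_of_mem_nonferm (K : SetSupercomposition n m) {B : Finset (Fin (n + 1))}
    {j : Fin n} (hB : B ∈ K.nonferm) (h : j.succ ∈ B) : K.blockOf (.inr j) = .inr B := by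
  rw [blockOf, dif_neg fun ⟨i, hi⟩ => K.notMem_ferm hB h i hi]
  congr 1
  ext l
  simp only [Finset.mem_biUnion, Finset.mem_filter, id]
  exact ⟨fun ⟨C, hC, hl⟩ => K.nonferm_eq_of_mem hC.1 hB hC.2 h ▸ hl, fun hl => ⟨B, ⟨hB, h⟩, hl⟩⟩

theorem blockOf_inr_eq_inl (K : SetSupercomposition n m) {i : Fin m} {j : Fin n} :
    K.blockOf (.inr j) = .inl i ↔ j.succ ∈ K.ferm i := by
  refine ⟨fun h => ?_, K.blockOf_inr_of_mem_ferm⟩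
  rcases K.cover j.succ (Fin.succ_ne_zero j) with ⟨i', hi'⟩ | ⟨B, hB, hjB⟩
  · rw [K.blockOf_inr_of_mem_ferm hi'] at h
    exact Sum.inl_injective h ▸ hi'
  · rw [K.blockOf_inr_of_mem_nonferm hB hjB] at h
    cases h

theorem blockOf_inr_eq_inr (K : SetSupercomposition n m) {B : Finset (Fin (n + 1))} {j : Fin n} :
    K.blockOf (.inr j) = .inr B ↔ B ∈ K.nonferm ∧ j.succ ∈ B := by
  refine ⟨fun h => ?_, fun h => K.blockOf_inr_of_mem_nonferm h.1 h.2⟩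
  rcases K.cover j.succ (Fin.succ_ne_zero j) with ⟨i', hi'⟩ | ⟨C, hC, hjC⟩
  · rw [K.blockOf_inr_of_mem_ferm hi'] at h
    cases h
  · rw [K.blockOf_inr_of_mem_nonferm hC hjC] at h
    exact Sum.inr_injective h ▸ ⟨hC, hjC⟩

/-- The equivalence relation of lying in the same block; the zeros of the fermionic blocks are
told apart. -/
noncomputable def toSetoid (K : SetSupercomposition n m) : Setoid (Fin m ⊕ Fin n) :=
  Setoid.ker K.blockOf

theorem toSetoid_inl_inl (K : SetSupercomposition n m) {i i' : Fin m} :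
    K.toSetoid (.inl i) (.inl i') ↔ i = i' :=
  Sum.inl_injective.eq_iff

theorem toSetoid_inl_inr (K : SetSupercomposition n m) {i : Fin m} {j : Fin n} :
    K.toSetoid (.inl i) (.inr j) ↔ j.succ ∈ K.ferm i :=
  eq_comm.trans K.blockOf_inr_eq_inl

theorem toSetoid_inr_inr (K : SetSupercomposition n m) {j k : Fin n} :
    K.toSetoid (.inr j) (.inr k) ↔ K.SameBlock j k := by
  change K.blockOf _ = K.blockOf _ ↔ _
  constructor
  · intro h
    rcases K.cover j.succ (Fin.succ_ne_zero j) with ⟨i, hi⟩ | ⟨B, hB, hjB⟩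
    · rw [K.blockOf_inr_of_mem_ferm hi, eq_comm, blockOf_inr_eq_inl] at h
      exact ⟨K.ferm i, by simp [blocks], hi, h⟩
    · rw [K.blockOf_inr_of_mem_nonferm hB hjB, eq_comm, blockOf_inr_eq_inr] at h
      exact ⟨B, by simp [blocks, hB], hjB, h.2⟩
  · rintro ⟨B, hB, hj, hk⟩
    simp only [blocks, Finset.mem_union, Finset.mem_image, Finset.mem_univ, true_and] at hB
    rcases hB with ⟨i, rfl⟩ | hB
    · rw [K.blockOf_inr_of_mem_ferm hj, K.blockOf_inr_of_mem_ferm hk]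
    · rw [K.blockOf_inr_of_mem_nonferm hB hj, K.blockOf_inr_of_mem_nonferm hB hk]

theorem forall_toSetoid_imp (K : SetSupercomposition n m) (a : Fin m → ℕ) (b : Fin n → ℕ) :
    (∀ x y, K.toSetoid x y → Sum.elim a b x = Sum.elim a b y) ↔
      (∀ i j, j.succ ∈ K.ferm i → a i = b j) ∧ ∀ j k, K.SameBlock j k → b j = b k := by
  constructor
  · exact fun h => ⟨fun i j hij => h (.inl i) (.inr j) (K.toSetoid_inl_inr.2 hij),
      fun j k hjk => h (.inr j) (.inr k) (K.toSetoid_inr_inr.2 hjk)⟩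
  · rintro ⟨h1, h2⟩ (i | j) (i' | k) h
    · rw [K.toSetoid_inl_inl.1 h]
    · exact h1 i k (K.toSetoid_inl_inr.1 h)
    · exact (h1 i' j (K.toSetoid_inl_inr.1 (K.toSetoid.symm' h))).symm
    · exact h2 j k (K.toSetoid_inr_inr.1 h)

/-- Identifies the pattern of a word with the kernel of its indices. `MemM` does not compare two
θ-indices; injectivity of `a` accounts for them. -/
theorem memM_iff (L : SetSupercomposition n m) {a : Fin m → ℕ} (ha : Function.Injective a)
    (b : Fin n → ℕ) :
    MemM L a b ↔ L.toSetoid = Setoid.ker (Sum.elim a b) := by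
  rw [Setoid.ext_iff]
  constructor
  · rintro ⟨h1, h2⟩ (i | j) (i' | k)
    · exact L.toSetoid_inl_inl.trans ha.eq_iff.symm
    · exact L.toSetoid_inl_inr.trans (h1 i k).symm
    · exact L.toSetoid.comm'.trans (L.toSetoid_inl_inr.trans ((h1 i' j).symm.trans eq_comm))
    · exact L.toSetoid_inr_inr.trans (h2 j k).symm
  · exact fun h => ⟨fun i j => (h (.inl i) (.inr j)).symm.trans L.toSetoid_inl_inr,
      fun j k => (h (.inr j) (.inr k)).symm.trans L.toSetoid_inr_inr⟩

/-- Inclusion of the relations implies `K ≤ L`, so equality follows from antisymmetry of strong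
coarsening. -/
theorem toSetoid_injective :
    Function.Injective (toSetoid : SetSupercomposition n m → Setoid (Fin m ⊕ Fin n)) := by
  have hle : ∀ K L : SetSupercomposition n m, K.toSetoid ≤ L.toSetoid → K ≤ L := by
    intro K L h
    rw [le_iff]
    have hf : ∀ i, K.ferm i ⊆ L.ferm i := by
      intro i k hk
      refine Fin.cases (fun _ => L.zero_mem_ferm i) (fun j hj => ?_) k hk
      exact L.toSetoid_inl_inr.1 (h (K.toSetoid_inl_inr.2 hj))
    refine ⟨hf, fun B hB => ?_⟩
    have key : ∀ j k : Fin n, j.succ ∈ B → k.succ ∈ B → L.toSetoid (.inr j) (.inr k) :=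
      fun j k hj hk => h (K.toSetoid_inr_inr.2 ⟨B, by simp [blocks, hB], hj, hk⟩)
    have hsucc : ∀ l ∈ B, ∃ j : Fin n, j.succ = l :=
      fun l hl => Fin.exists_succ_eq.2 (K.ne_zero_of_mem hB hl)
    obtain ⟨l, hl⟩ := K.nonempty B hB
    obtain ⟨j, rfl⟩ := hsucc l hl
    rcases L.cover j.succ (Fin.succ_ne_zero j) with ⟨i, hi⟩ | ⟨D, hD, hjD⟩
    · refine Or.inl ⟨i, fun l' hl' => ?_⟩
      obtain ⟨k, rfl⟩ := hsucc l' hl'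
      exact L.toSetoid_inl_inr.1 (L.toSetoid.trans' (L.toSetoid_inl_inr.2 hi) (key j k hl hl'))
    · refine Or.inr ⟨D, hD, fun l' hl' => ?_⟩
      obtain ⟨k, rfl⟩ := hsucc l' hl'
      have e : L.blockOf (.inr j) = L.blockOf (.inr k) := key j k hl hl'
      rw [L.blockOf_inr_of_mem_nonferm hD hjD, eq_comm, blockOf_inr_eq_inr] at e
      exact e.2
  exact fun K L h => le_antisymm (hle K L h.le) (hle L K h.ge)

open Classical in
/-- The set supercomposition with a given relation of lying in the same block. -/
noncomputable def ofSetoid (r : Setoid (Fin m ⊕ Fin n))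
    (h : ∀ i i', r (.inl i) (.inl i') → i = i') (hm : m ≤ n + 1) : SetSupercomposition n m where
  ferm i := insert 0
    ((Finset.univ.filter fun j => r (.inl i) (.inr j)).map (Fin.succEmb n))
  nonferm := (Finset.univ.filter fun j => ∀ i, ¬ r (.inl i) (.inr j)).image fun j =>
    (Finset.univ.filter fun k => r (.inr j) (.inr k)).map (Fin.succEmb n)
  le_succ := hm
  zero_mem_ferm i := Finset.mem_insert_self _ _
  zero_notMem B hB h0 := by
    obtain ⟨j, -, rfl⟩ := Finset.mem_image.1 hB
    obtain ⟨k, -, e⟩ := Finset.mem_map.1 h0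
    exact Fin.succ_ne_zero k e
  nonempty B hB := by
    obtain ⟨j, -, rfl⟩ := Finset.mem_image.1 hB
    exact ⟨j.succ, Finset.mem_map.2 ⟨j, by simp, rfl⟩⟩
  cover k hk := by
    obtain ⟨j, rfl⟩ := Fin.exists_succ_eq.2 hk
    by_cases hj : ∃ i, r (.inl i) (.inr j)
    · obtain ⟨i, hi⟩ := hj
      exact Or.inl ⟨i, Finset.mem_insert_of_mem (Finset.mem_map.2 ⟨j, by simpa using hi, rfl⟩)⟩
    · refine Or.inr ⟨_, Finset.mem_image.2 ⟨j, by simpa using hj, rfl⟩, ?_⟩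
      exact Finset.mem_map.2 ⟨j, by simp, rfl⟩
  ferm_inter i i' hii k hk := by
    by_contra h0
    simp only [Finset.mem_singleton] at h0
    simp only [Finset.mem_inter, Finset.mem_insert, h0, false_or, Finset.mem_map,
      Finset.mem_filter, Finset.mem_univ, true_and] at hk
    obtain ⟨⟨j, hj, rfl⟩, j', hj', e⟩ := hk
    obtain rfl := Fin.succ_injective _ e
    exact hii (h i i' (r.trans' hj (r.symm' hj')))
  ferm_disjoint i B hB := by
    obtain ⟨j, hj, rfl⟩ := Finset.mem_image.1 hB
    rw [Finset.disjoint_left]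
    intro k hk hk'
    obtain ⟨l, hl, rfl⟩ := Finset.mem_map.1 hk'
    simp only [Finset.mem_insert, Finset.mem_map, Finset.mem_filter, Finset.mem_univ,
      true_and] at hk hl hj
    rcases hk with hk | ⟨l', hl', e⟩
    · exact Fin.succ_ne_zero l hk
    · obtain rfl := Fin.succ_injective _ e
      exact hj i (r.trans' hl' (r.symm' hl))
  nonferm_disjoint B hB C hC hBC := by
    obtain ⟨j, hj, rfl⟩ := Finset.mem_image.1 hB
    obtain ⟨j', hj', rfl⟩ := Finset.mem_image.1 hC
    rw [Finset.disjoint_left]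
    intro k hk hk'
    apply hBC
    simp only [Finset.mem_map, Finset.mem_filter, Finset.mem_univ, true_and] at hk hk'
    obtain ⟨l, hl, rfl⟩ := hk
    obtain ⟨l', hl', e⟩ := hk'
    obtain rfl := Fin.succ_injective _ e
    congr 2
    funext k
    exact propext ⟨fun h => r.trans' hl' (r.trans' (r.symm' hl) h),
      fun h => r.trans' hl (r.trans' (r.symm' hl') h)⟩

theorem toSetoid_ofSetoid (r : Setoid (Fin m ⊕ Fin n))
    (h : ∀ i i', r (.inl i) (.inl i') → i = i') (hm : m ≤ n + 1) :
    (ofSetoid r h hm).toSetoid = r := by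
  have hf : ∀ i j, (ofSetoid r h hm).toSetoid (.inl i) (.inr j) ↔ r (.inl i) (.inr j) := by
    intro i j
    rw [toSetoid_inl_inr]
    simp [ofSetoid, Fin.succ_ne_zero]
  rw [Setoid.ext_iff]
  rintro (i | j) (i' | k)
  · rw [toSetoid_inl_inl]
    exact ⟨fun e => e ▸ r.refl' _, h i i'⟩
  · exact hf i k
  · rw [Setoid.comm', hf, Setoid.comm']
  · by_cases hj : ∃ i, r (.inl i) (.inr j)
    · obtain ⟨i, hi⟩ := hj
      constructor
      · exact fun hjk => r.trans' (r.symm' hi) ((hf i k).1 (Setoid.trans' _ ((hf i j).2 hi) hjk))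
      · exact fun hjk => Setoid.trans' _ (Setoid.symm' _ ((hf i j).2 hi))
          ((hf i k).2 (r.trans' hi hjk))
    · classical
      have hj' : (Finset.univ.filter fun k => r (.inr j) (.inr k)).map (Fin.succEmb n) ∈
          (ofSetoid r h hm).nonferm := by
        refine Finset.mem_image.2 ⟨j, by simpa using hj, ?_⟩
        congr
      change blockOf _ _ = blockOf _ _ ↔ _
      rw [blockOf_inr_of_mem_nonferm _ hj' (Finset.mem_map.2 ⟨j, by simp, rfl⟩),
        eq_comm, blockOf_inr_eq_inr]
      simp only [hj', true_and, Finset.mem_map, Finset.mem_filter, Finset.mem_univ]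
      exact ⟨fun ⟨l, hl, e⟩ => Fin.succ_injective _ e ▸ hl, fun hk => ⟨k, hk, rfl⟩⟩

theorem sameBlock_iff_underlying (K : SetSupercomposition n m) (j k : Fin n) :
    K.SameBlock j k ↔ ∃ B ∈ K.underlying, j.succ ∈ B ∧ k.succ ∈ B := by
  constructor
  · rintro ⟨B, hB, hj, hk⟩
    refine ⟨B \ {0}, ?_, by simp [hj, Fin.succ_ne_zero], by simp [hk, Fin.succ_ne_zero]⟩
    exact Finset.mem_filter.2 ⟨Finset.mem_image_of_mem _ hB, j.succ, by simp [hj, Fin.succ_ne_zero]⟩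
  · rintro ⟨B, hB, hj, hk⟩
    obtain ⟨C, hC, rfl⟩ := Finset.mem_image.1 (Finset.mem_filter.1 hB).1
    exact ⟨C, hC, Finset.sdiff_subset hj, Finset.sdiff_subset hk⟩

/-- The meet becomes intersection of relations, which makes the weights in `h_K` accessible.
Elements in fermionic blocks of the same index in both form one class; the other classes are
intersections of underlying blocks with these elements removed. -/
theorem toSetoid_inf (K L : SetSupercomposition n m) :
    (K ⊓ L).toSetoid = K.toSetoid ⊓ L.toSetoid := by
  have hf : ∀ i j, (K ⊓ L).toSetoid (.inl i) (.inr j) ↔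
      K.toSetoid (.inl i) (.inr j) ∧ L.toSetoid (.inl i) (.inr j) := by
    intro i j
    rw [toSetoid_inl_inr, toSetoid_inl_inr, toSetoid_inl_inr]
    exact Finset.mem_inter
  rw [Setoid.ext_iff]
  rintro (i | j) (i' | k)
  · rw [toSetoid_inl_inl, Setoid.inf_iff_and, toSetoid_inl_inl, toSetoid_inl_inl, and_self]
  · exact hf i k
  · rw [Setoid.comm', hf, Setoid.comm' K.toSetoid, Setoid.comm' L.toSetoid]
    exact Iff.rfl
  · rw [Setoid.inf_iff_and]
    constructor
    · intro h
      rw [toSetoid_inr_inr, sameBlock_iff_underlying] at h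
      obtain ⟨D, hD, hj, hk⟩ := h
      rcases ((K ⊓ L).mem_underlying D).1 hD with ⟨-, ⟨i, rfl⟩ | hD⟩
      · have hj' := (hf i j).1 ((K ⊓ L).toSetoid_inl_inr.2 (Finset.sdiff_subset hj))
        have hk' := (hf i k).1 ((K ⊓ L).toSetoid_inl_inr.2 (Finset.sdiff_subset hk))
        exact ⟨Setoid.trans' _ (Setoid.symm' _ hj'.1) hk'.1,
          Setoid.trans' _ (Setoid.symm' _ hj'.2) hk'.2⟩
      · obtain ⟨-, B, hB, C, hC, rfl⟩ := (mem_nonferm_min K L D).1 hD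
        simp only [Finset.mem_sdiff, Finset.mem_inter] at hj hk
        rw [toSetoid_inr_inr, toSetoid_inr_inr, sameBlock_iff_underlying, sameBlock_iff_underlying]
        exact ⟨⟨B, hB, hj.1.1, hk.1.1⟩, C, hC, hj.1.2, hk.1.2⟩
    · rintro ⟨hK, hL⟩
      by_cases hA : ∃ i, K.toSetoid (.inl i) (.inr j) ∧ L.toSetoid (.inl i) (.inr j)
      · obtain ⟨i, hi⟩ := hA
        exact Setoid.trans' _ (Setoid.symm' _ ((hf i j).2 hi))
          ((hf i k).2 ⟨Setoid.trans' _ hi.1 hK, Setoid.trans' _ hi.2 hL⟩)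
      -- If `j` is not in a common fermionic block, neither is anything related to it on both sides,
      -- so nothing of its class is removed.
      · have hA' : ∀ l : Fin n, K.toSetoid (.inr j) (.inr l) → L.toSetoid (.inr j) (.inr l) →
            l.succ ∉ Finset.univ.biUnion fun i => K.ferm i ∩ L.ferm i := by
          intro l h1 h2 hl
          obtain ⟨i, -, hi⟩ := Finset.mem_biUnion.1 hl
          rw [Finset.mem_inter, ← toSetoid_inl_inr, ← toSetoid_inl_inr] at hi
          exact hA ⟨i, Setoid.trans' _ hi.1 (Setoid.symm' _ h1),
            Setoid.trans' _ hi.2 (Setoid.symm' _ h2)⟩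
        have hj := hA' j (Setoid.refl' _ _) (Setoid.refl' _ _)
        have hk := hA' k hK hL
        rw [toSetoid_inr_inr, sameBlock_iff_underlying] at hK hL
        obtain ⟨B, hB, hjB, hkB⟩ := hK
        obtain ⟨C, hC, hjC, hkC⟩ := hL
        have hjD := Finset.mem_sdiff.2 ⟨Finset.mem_inter.2 ⟨hjB, hjC⟩, hj⟩
        rw [toSetoid_inr_inr]
        exact ⟨_, Finset.mem_union_right _
          ((mem_nonferm_min K L _).2 ⟨⟨_, hjD⟩, B, hB, C, hC, rfl⟩), hjD,
          Finset.mem_sdiff.2 ⟨Finset.mem_inter.2 ⟨hkB, hkC⟩, hk⟩⟩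

end SetSupercomposition

/-! ### Counting related pairs, and sorting the fermionic positions -/

open Classical in
/-- The number of related pairs of an equivalence relation on a finite type. -/
noncomputable def relCard {X : Type*} [Fintype X] (r : Setoid X) : ℕ :=
  (Finset.univ.filter fun p : X × X => r p.1 p.2).card

theorem relCard_mono {X : Type*} [Fintype X] {r s : Setoid X} (h : r ≤ s) :
    relCard r ≤ relCard s := by
  classical
  exact Finset.card_le_card (Finset.monotone_filter_right _ fun _ _ hp => h hp)

theorem eq_of_relCard_le {X : Type*} [Fintype X] {r s : Setoid X} (h : r ≤ s)
    (hc : relCard s ≤ relCard r) : r = s := by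
  classical
  refine le_antisymm h fun x y hxy => ?_
  have e := Finset.eq_of_subset_of_card_le (Finset.monotone_filter_right _ fun p _ hp => h hp) hc
  have := (Finset.ext_iff.1 e (x, y)).2 (by simpa using hxy)
  simpa using this

theorem relCard_comap {X : Type*} [Fintype X] (r : Setoid X) (e : Equiv.Perm X) :
    relCard (r.comap e) = relCard r := by
  classical
  refine Finset.card_bij (fun p _ => (e p.1, e p.2)) ?_ ?_ ?_
  · intro p hp
    simpa [Setoid.comap_rel] using hp
  · rintro ⟨p, q⟩ _ ⟨p', q'⟩ _ h
    simpa using h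
  · rintro ⟨p, q⟩ h
    exact ⟨(e.symm p, e.symm q), by simpa [Setoid.comap_rel] using h, by simp⟩

theorem relCard_le {X : Type*} [Fintype X] (r : Setoid X) :
    relCard r ≤ Fintype.card X * Fintype.card X :=
  (Finset.card_le_univ _).trans (Fintype.card_prod X X).le

/-- The permutation of `Fin m ⊕ Fin n` induced by a permutation of `Fin m`. -/
def permLeft (n : ℕ) (τ : Equiv.Perm (Fin m)) : Equiv.Perm (Fin m ⊕ Fin n) :=
  Equiv.sumCongr τ (Equiv.refl _)

theorem elim_permLeft (a : Fin m → ℕ) (b : Fin n → ℕ) (τ : Equiv.Perm (Fin m)) :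
    Sum.elim (a ∘ τ) b = Sum.elim a b ∘ permLeft n τ := by
  funext x
  rcases x with i | j <;> rfl

/-- The least `j + 1` with `j` related to the `i`th element on the left, or `0`. -/
noncomputable def leastRelated (r : Setoid (Fin m ⊕ Fin n)) (i : Fin m) : ℕ :=
  sInf {k | ∃ j : Fin n, r (.inl i) (.inr j) ∧ (j : ℕ) + 1 = k}

theorem leastRelated_comap (r : Setoid (Fin m ⊕ Fin n)) (τ : Equiv.Perm (Fin m)) :
    leastRelated (r.comap (permLeft n τ)) = leastRelated r ∘ τ := rfl

theorem leastRelated_le (r : Setoid (Fin m ⊕ Fin n)) (i : Fin m) : leastRelated r i < n + 1 := by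
  by_cases h : ∃ j, r (.inl i) (.inr j)
  · obtain ⟨j, hj⟩ := h
    have : leastRelated r i ≤ (j : ℕ) + 1 := Nat.sInf_le ⟨j, hj, rfl⟩
    omega
  · have : {k | ∃ j : Fin n, r (.inl i) (.inr j) ∧ (j : ℕ) + 1 = k} = ∅ := by
      ext k
      simp only [Set.mem_ofPred_eq, Set.mem_empty_iff_false, iff_false]
      exact fun ⟨j, hj, _⟩ => h ⟨j, hj⟩
    rw [leastRelated, this, Nat.sInf_empty]
    omega

/-- A nonzero value names a position on the right whose class contains only one position on the
left. The value 0 means that there is no such position, which happens at most once. -/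
theorem leastRelated_injective {r : Setoid (Fin m ⊕ Fin n)}
    (hsep : ∀ i i', r (.inl i) (.inl i') → i = i')
    (hiso : ∀ i i', (∀ j, ¬ r (.inl i) (.inr j)) → (∀ j, ¬ r (.inl i') (.inr j)) → i = i') :
    Function.Injective (leastRelated r) := by
  have hmem : ∀ i j, r (.inl i) (.inr j) →
      ∃ k : Fin n, r (.inl i) (.inr k) ∧ (k : ℕ) + 1 = leastRelated r i :=
    fun i j h => Nat.sInf_mem (s := {k | ∃ j : Fin n, r (.inl i) (.inr j) ∧ (j : ℕ) + 1 = k})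
      ⟨_, j, h, rfl⟩
  have hzero : ∀ i, leastRelated r i = 0 → ∀ j, ¬ r (.inl i) (.inr j) := by
    intro i h j hj
    obtain ⟨k, -, hk⟩ := hmem i j hj
    omega
  intro i i' h
  by_cases h0 : leastRelated r i = 0
  · exact hiso i i' (hzero i h0) (hzero i' (h ▸ h0))
  · have hne : ∀ i, leastRelated r i ≠ 0 → ∃ k : Fin n, r (.inl i) (.inr k) ∧
        (k : ℕ) + 1 = leastRelated r i := by
      intro i hi
      obtain ⟨k, j, hj, -⟩ := Nat.nonempty_of_pos_sInf (Nat.pos_of_ne_zero hi)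
      exact hmem i j hj
    obtain ⟨k, hk, ek⟩ := hne i h0
    obtain ⟨k', hk', ek'⟩ := hne i' (h ▸ h0)
    have : k = k' := Fin.ext (by omega)
    subst this
    exact hsep i i' (r.trans' hk (r.symm' hk'))

namespace SetSupercomposition

/-- Two fermionic blocks share only 0, so the difference is the first block without 0, whatever the
second one is. The superpartition condition thereby becomes strict monotonicity of one function. -/
theorem minOrZero_ferm_sdiff (K : SetSupercomposition n m) {i i' : Fin m} (h : i ≠ i') :
    minOrZero (K.ferm i \ K.ferm i') = leastRelated K.toSetoid i := by
  rw [minOrZero, leastRelated]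
  congr 1
  ext k
  constructor
  · rintro ⟨l, hl, rfl⟩
    rw [Finset.mem_sdiff] at hl
    obtain ⟨j, rfl⟩ := Fin.exists_succ_eq.2 fun e : l = 0 => hl.2 (e ▸ K.zero_mem_ferm i')
    exact ⟨j, K.toSetoid_inl_inr.2 hl.1, rfl⟩
  · rintro ⟨j, hj, rfl⟩
    rw [toSetoid_inl_inr] at hj
    exact ⟨j.succ, Finset.mem_sdiff.2
      ⟨hj, fun hj' => h (K.ferm_eq_of_mem (Fin.succ_ne_zero j) hj hj')⟩, rfl⟩

theorem isSetSuperpartition_iff (K : SetSupercomposition n m) :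
    K.IsSetSuperpartition ↔ StrictMono (leastRelated K.toSetoid) := by
  constructor
  · intro h i i' hi
    have := (h i i' hi).2
    rwa [K.minOrZero_ferm_sdiff hi.ne, K.minOrZero_ferm_sdiff hi.ne'] at this
  · intro h i i' hi
    have hlt := h hi
    rw [← K.minOrZero_ferm_sdiff hi.ne, ← K.minOrZero_ferm_sdiff hi.ne'] at hlt
    refine ⟨fun e => ?_, hlt⟩
    rw [e] at hlt
    exact lt_irrefl _ hlt

end SetSupercomposition

open SetSupercomposition

/-- Sort the left positions by `leastRelated`; injectivity makes the sorted sequence strictly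
increasing. -/
theorem exists_superpartition {r : Setoid (Fin m ⊕ Fin n)}
    (hsep : ∀ i i', r (.inl i) (.inl i') → i = i')
    (hiso : ∀ i i', (∀ j, ¬ r (.inl i) (.inr j)) → (∀ j, ¬ r (.inl i') (.inr j)) → i = i') :
    ∃ (τ : Equiv.Perm (Fin m)) (J : SetSuperpartition n m),
      J.1.toSetoid = r.comap (permLeft n τ) := by
  have hinj := leastRelated_injective hsep hiso
  -- The bound on the fermionic degree is automatic: `leastRelated` injects `Fin m` into `{0, …,
  -- n}`.
  have hm : m ≤ n + 1 := by
    have := Finset.card_le_card_of_injOn (s := (Finset.univ : Finset (Fin m)))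
      (t := Finset.range (n + 1)) (leastRelated r)
      (fun i _ => by simpa using leastRelated_le r i) hinj.injOn
    simpa using this
  let τ := Tuple.sort (leastRelated r)
  have hmono : StrictMono (leastRelated r ∘ τ) :=
    (Tuple.monotone_sort _).strictMono_of_injective (hinj.comp τ.injective)
  let J := ofSetoid (r.comap (permLeft n τ)) (fun i i' h => τ.injective (hsep _ _ h)) hm
  have hJ : J.toSetoid = r.comap (permLeft n τ) := toSetoid_ofSetoid _ _ _
  exact ⟨τ, ⟨J, J.isSetSuperpartition_iff.2 (by rw [hJ]; exact hmono)⟩, hJ⟩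

/-- Sorted representatives are unique: `τ` carries one strictly increasing sequence to another, so
it is itself increasing, hence the identity. -/
theorem eq_one_of_toSetoid_eq {J J' : SetSuperpartition n m} {τ : Equiv.Perm (Fin m)}
    (h : J'.1.toSetoid = J.1.toSetoid.comap (permLeft n τ)) : τ = 1 := by
  have h1 := J.1.isSetSuperpartition_iff.1 J.2
  have h2 := J'.1.isSetSuperpartition_iff.1 J'.2
  rw [h, leastRelated_comap] at h2
  have h3 : StrictMono τ := fun i j hij => h1.lt_iff_lt.1 (h2 hij)
  have h4 : StrictMono (id : Fin m → Fin m) := strictMono_id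
  ext i
  have := congrFun ((StrictMono.range_inj h3 h4).1 (by simp)) i
  rw [this]; rfl

theorem superpartition_ext {J J' : SetSuperpartition n m} (h : J.1.toSetoid = J'.1.toSetoid) :
    J = J' := Subtype.ext (toSetoid_injective h)

instance {X : Type*} [Finite X] : Finite (Setoid X) :=
  Finite.of_injective (fun r => (r : X → X → Prop))
    fun _ _ h => Setoid.ext fun x y => iff_of_eq (congrFun (congrFun h x) y)

instance : Finite (SetSuperpartition n m) :=
  Finite.of_injective (fun J : SetSuperpartition n m => J.1.toSetoid)
    fun _ _ => superpartition_ext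

/-! ### Power sums over arbitrary relations -/

open Classical in
/-- The sum of the words `θ_{a_1} ⋯ θ_{a_m} x_{b_1} ⋯ x_{b_n}` whose indices are constant on the
classes of `r`. -/
noncomputable def constSum (r : Setoid (Fin m ⊕ Fin n)) : Series :=
  wordSum fun a b => if r ≤ Setoid.ker (Sum.elim a b) then 1 else 0

theorem powerSum_eq_constSum (K : SetSupercomposition n m) :
    powerSum K = constSum K.toSetoid := by
  rw [powerSum, constSum]
  congr 1
  funext a b
  classical
  exact if_congr ((K.forall_toSetoid_imp a b).symm) rfl rfl

theorem ker_comp_perm (σ : Equiv.Perm ℕ) (a : Fin m → ℕ) (b : Fin n → ℕ) :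
    Setoid.ker (Sum.elim (σ ∘ a) (σ ∘ b)) = Setoid.ker (Sum.elim a b) := by
  rw [← Sum.comp_elim]
  exact Setoid.ext fun x y => σ.injective.eq_iff

theorem constSum_mem (r : Setoid (Fin m ⊕ Fin n)) : constSum r ∈ sNCSym :=
  wordSum_mem fun σ a b => by rw [ker_comp_perm]

theorem le_ker_comp_permLeft (r : Setoid (Fin m ⊕ Fin n)) (τ : Equiv.Perm (Fin m))
    (a : Fin m → ℕ) (b : Fin n → ℕ) :
    r.comap (permLeft n τ) ≤ Setoid.ker (Sum.elim (a ∘ τ) b) ↔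
      r ≤ Setoid.ker (Sum.elim a b) := by
  rw [elim_permLeft]
  constructor
  · intro h x y hxy
    have := @h ((permLeft n τ).symm x) ((permLeft n τ).symm y) (by simpa [Setoid.comap_rel] using hxy)
    simpa [Setoid.ker_def] using this
  · intro h x y hxy
    exact h hxy

theorem constSum_comap (r : Setoid (Fin m ⊕ Fin n)) (τ : Equiv.Perm (Fin m)) :
    constSum r = ((Equiv.Perm.sign τ : ℤ) : ℚ) • constSum (r.comap (permLeft n τ)) := by
  rw [constSum, constSum, ← wordSum_comp_perm]
  congr 1
  funext a b
  classical
  exact if_congr (le_ker_comp_permLeft r τ a b).symm rfl rfl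

/-- Exchanging two singleton classes on the left preserves `r` but changes the sign of the sum. -/
theorem constSum_eq_zero_of_isolated {r : Setoid (Fin m ⊕ Fin n)}
    (hsep : ∀ i i', r (.inl i) (.inl i') → i = i') {i i' : Fin m} (hii : i ≠ i')
    (hi : ∀ j, ¬ r (.inl i) (.inr j)) (hi' : ∀ j, ¬ r (.inl i') (.inr j)) : constSum r = 0 := by
  have hl : ∀ k, k = i ∨ k = i' → ∀ y, r (.inl k) y → y = .inl k := by
    rintro k hk (l | j) h
    · rw [hsep _ _ h]
    · rcases hk with rfl | rfl
      · exact absurd h (hi j)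
      · exact absurd h (hi' j)
  have key : ∀ x y, r x y → r (permLeft n (Equiv.swap i i') x) (permLeft n (Equiv.swap i i') y) := by
    rintro (k | j) y h
    · by_cases hk : k = i ∨ k = i'
      · rw [hl k hk y h]
      · rcases y with l | j
        · rw [hsep _ _ h]
        · have : permLeft n (Equiv.swap i i') (.inl k) = .inl k := by
            rw [not_or] at hk
            exact congrArg Sum.inl (Equiv.swap_apply_of_ne_of_ne hk.1 hk.2)
          rw [this]
          exact h
    · rcases y with l | j'
      · by_cases hk : l = i ∨ l = i'
        · cases hl l hk _ (r.symm' h)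
        · have : permLeft n (Equiv.swap i i') (.inl l) = .inl l := by
            rw [not_or] at hk
            exact congrArg Sum.inl (Equiv.swap_apply_of_ne_of_ne hk.1 hk.2)
          rw [this]
          exact h
      · exact h
  have e : r.comap (permLeft n (Equiv.swap i i')) = r := by
    have hle : r ≤ r.comap (permLeft n (Equiv.swap i i')) := fun {x y} h => key x y h
    -- One inclusion suffices, since both relations have the same number of related pairs.
    exact (eq_of_relCard_le hle (relCard_comap _ _).le).symm
  have h := constSum_comap r (Equiv.swap i i')
  rw [e, Equiv.Perm.sign_swap hii] at h
  simp only [Units.val_neg, Units.val_one, Int.cast_neg, Int.cast_one] at h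
  ext S w
  have h1 := congrFun (congrFun h S) w
  rw [Series.smul_apply] at h1
  rw [zero_apply]
  linarith

/-- A power sum over an arbitrary relation is zero or a power sum of a set superpartition, up to a
scalar. -/
theorem constSum_eq_zero_or {r : Setoid (Fin m ⊕ Fin n)}
    (hsep : ∀ i i', r (.inl i) (.inl i') → i = i') :
    constSum r = 0 ∨ ∃ (J : SetSuperpartition n m) (ε : ℚ),
      constSum r = ε • powerSum J.1 ∧ relCard J.1.toSetoid = relCard r := by
  by_cases hiso : ∀ i i', (∀ j, ¬ r (.inl i) (.inr j)) → (∀ j, ¬ r (.inl i') (.inr j)) → i = i'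
  · obtain ⟨τ, J, hJ⟩ := exists_superpartition hsep hiso
    refine Or.inr ⟨J, (Equiv.Perm.sign τ : ℤ), ?_, ?_⟩
    · rw [powerSum_eq_constSum, hJ, ← constSum_comap]
    · rw [hJ, relCard_comap]
  · push Not at hiso
    obtain ⟨i, i', hi, hi', hii⟩ := hiso
    exact Or.inl (constSum_eq_zero_of_isolated hsep hii hi hi')

/-! ### Coordinates indexed by superpartitions, and the power sum basis -/

/-- A labelling of a finite type by natural numbers with prescribed kernel. -/
noncomputable def label {X : Type*} [Finite X] (r : Setoid X) (x : X) : ℕ :=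
  Finite.equivFin (Quotient r) (Quotient.mk r x)

theorem label_eq_iff {X : Type*} [Finite X] (r : Setoid X) (x y : X) :
    label r x = label r y ↔ r x y :=
  Fin.val_injective.eq_iff.trans ((Equiv.apply_eq_iff_eq _).trans Quotient.eq)

theorem elim_label (r : Setoid (Fin m ⊕ Fin n)) :
    Sum.elim (label r ∘ Sum.inl) (label r ∘ Sum.inr) = label r :=
  Sum.elim_comp_inl_inr (label r)

/-- The coefficient of a series at a word whose pattern of equal indices is `J`. -/
noncomputable def coeffAt (J : SetSuperpartition n m) : Series →ₗ[ℚ] ℚ :=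
  wordCoeff (label J.1.toSetoid ∘ Sum.inl) (label J.1.toSetoid ∘ Sum.inr)

theorem label_inl_injective (K : SetSupercomposition n m) :
    Function.Injective (label K.toSetoid ∘ Sum.inl) := fun _ _ h =>
  K.toSetoid_inl_inl.1 ((label_eq_iff _ _ _).1 h)

theorem le_of_coeffAt_ne_zero {J : SetSuperpartition n m} {f : Series} (h : coeffAt J f ≠ 0) :
    ∃ S w, f S w ≠ 0 ∧ S.card = m ∧ w.length = n :=
  ⟨_, _, right_ne_zero_of_mul h,
    by rw [Finset.card_image_of_injective _ (label_inl_injective J.1)]; simp, by simp⟩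

theorem coeffAt_powerSum (J : SetSuperpartition n m) (K : SetSupercomposition n m) :
    coeffAt J (powerSum K) = by classical exact ∑ τ : Equiv.Perm (Fin m),
      ((Equiv.Perm.sign τ : ℤ) : ℚ) *
        if K.toSetoid ≤ J.1.toSetoid.comap (permLeft n τ) then 1 else 0 := by
  classical
  rw [powerSum_eq_constSum, coeffAt, constSum, wordCoeff_wordSum (label_inl_injective J.1)]
  refine Finset.sum_congr rfl fun τ _ => ?_
  rw [elim_permLeft, elim_label]
  have e : Setoid.ker (label J.1.toSetoid ∘ permLeft n τ) =
      J.1.toSetoid.comap (permLeft n τ) :=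
    Setoid.ext fun x y => label_eq_iff _ _ _
  rw [e]

/-- Some term survives, so `I` refines a rearrangement of `J`. If `J` has no more related pairs, the
two agree, and both being sorted makes the rearrangement trivial. -/
theorem coeffAt_powerSum_ne_zero {J I : SetSuperpartition n m}
    (h : coeffAt J (powerSum I.1) ≠ 0) :
    J = I ∨ relCard I.1.toSetoid < relCard J.1.toSetoid := by
  rw [coeffAt_powerSum] at h
  obtain ⟨τ, -, hτ⟩ := Finset.exists_ne_zero_of_sum_ne_zero h
  have hle : I.1.toSetoid ≤ J.1.toSetoid.comap (permLeft n τ) := by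
    by_contra hn
    rw [if_neg hn, mul_zero] at hτ
    exact hτ rfl
  rw [or_iff_not_imp_right, not_lt]
  intro hc
  have e := eq_of_relCard_le hle (by rwa [relCard_comap])
  have hτ1 := eq_one_of_toSetoid_eq e
  subst hτ1
  refine (superpartition_ext (e.trans (Setoid.ext fun x y => ?_))).symm
  rw [Setoid.comap_rel]
  rcases x with i | j <;> rcases y with i' | j' <;> exact Iff.rfl

/-- A surviving `τ` makes `I` refine its own rearrangement, which has equally many related pairs;
hence they agree and `τ = 1`. -/
theorem coeffAt_powerSum_self (I : SetSuperpartition n m) : coeffAt I (powerSum I.1) = 1 := by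
  rw [coeffAt_powerSum, Finset.sum_eq_single 1]
  · rw [if_pos]
    · simp
    · intro x y h
      rw [Setoid.comap_rel]
      rcases x with i | j <;> rcases y with i' | j' <;> exact h
  · intro τ _ hτ
    rw [if_neg, mul_zero]
    exact fun hle => hτ (eq_one_of_toSetoid_eq
      (eq_of_relCard_le hle (relCard_comap _ _).le))
  · exact fun h => absurd (Finset.mem_univ _) h

/-- A normal form is either null-symmetric, where every symmetric series vanishes, or acquires the
pattern of a superpartition once its θ's are sorted. -/
theorem eq_zero_of_coeffAt {f : Series} (hf : f ∈ sNCSym)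
    (h : ∀ (n m : ℕ) (J : SetSuperpartition n m), coeffAt J f = 0) : f = 0 := by
  ext S w
  obtain ⟨a, b, ha, hS, hw⟩ := exists_word_eq S w
  rw [← hS, ← hw, zero_apply]
  by_cases hnull : NullSymmetric a b
  · exact apply_eq_zero_of_nullSymmetric hf ha hnull
  · obtain ⟨τ, J, hJ⟩ := exists_superpartition (r := Setoid.ker (Sum.elim a b))
      (fun i i' h => ha h)
      (fun i i' hi hi' => by
        by_contra hii
        exact hnull (nullSymmetric_of_isolated ha hii (fun k e => hi k e.symm)
          (fun k e => hi' k e.symm)))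
    have e : wordCoeff (a ∘ τ) b f = coeffAt J f := by
      refine wordCoeff_eq_of_ker hf fun x y => ?_
      rw [elim_label, label_eq_iff, hJ, elim_permLeft]
      exact Iff.rfl
    rw [h, wordCoeff_comp] at e
    refine apply_eq_zero_of_wordCoeff ha ((mul_eq_zero.1 e).resolve_left ?_)
    exact_mod_cast (Equiv.Perm.sign τ).ne_zero

/-- Bounded degree leaves finitely many bidegrees, each with finitely many superpartitions. -/
theorem finite_coeffAt_ne_zero {f : Series} (hf : f ∈ sNCSym) :
    (Function.support fun I : Σ d : ℕ × ℕ, SetSuperpartition d.1 d.2 => coeffAt I.2 f).Finite := by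
  obtain ⟨d, hd⟩ := (mem_sNCSym.1 hf).1
  refine Set.Finite.subset (Set.Finite.biUnion ((Set.finite_Iic d).prod (Set.finite_Iic d))
    fun p _ => Set.finite_range (Sigma.mk (β := fun d : ℕ × ℕ => SetSuperpartition d.1 d.2) p)) ?_
  rintro ⟨p, J⟩ hJ
  obtain ⟨S, w, h, hS, hw⟩ := le_of_coeffAt_ne_zero hJ
  have := hd S w h
  dsimp only at hS hw
  simp only [Set.mem_iUnion]
  refine ⟨p, ⟨?_, ?_⟩, J, rfl⟩
  · change p.1 ≤ d
    omega
  · change p.2 ≤ d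
    omega

/-- The coefficients of a symmetric series at representatives of the orbits of words. -/
noncomputable def coeffs :
    sNCSym →ₗ[ℚ] (Σ d : ℕ × ℕ, SetSuperpartition d.1 d.2) →₀ ℚ where
  toFun f := Finsupp.ofSupportFinite (fun I => coeffAt I.2 f) (finite_coeffAt_ne_zero f.2)
  map_add' f g := by
    ext I
    exact map_add (coeffAt I.2) f.1 g.1
  map_smul' c f := by
    ext I
    exact map_smul (coeffAt I.2) c f.1

theorem coeffs_apply (f : sNCSym) (I : Σ d : ℕ × ℕ, SetSuperpartition d.1 d.2) :
    coeffs f I = coeffAt I.2 f := rfl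

theorem coeffs_injective : Function.Injective coeffs := by
  rw [injective_iff_map_eq_zero]
  intro f hf
  refine Subtype.ext (eq_zero_of_coeffAt f.2 fun n m J => ?_)
  exact DFunLike.congr_fun hf ⟨(n, m), J⟩

theorem exists_powerSum_basis :
    ∃ p : Module.Basis (Σ d : ℕ × ℕ, SetSuperpartition d.1 d.2) ℚ sNCSym,
      ∀ I, (p I : Series) = powerSum I.2.1 := by
  have hmem : ∀ I : Σ d : ℕ × ℕ, SetSuperpartition d.1 d.2, powerSum I.2.1 ∈ sNCSym :=
    fun I => by rw [powerSum_eq_constSum]; exact constSum_mem _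
  suffices h : _ from
    let ⟨p, hp⟩ := exists_basis_of_triangular coeffs coeffs_injective
      -- Power sums have their off-diagonal coefficients at coarser patterns, so the rank must fall
      -- as `relCard` grows; the number of all pairs is an upper bound to subtract from.
      (fun I => Fintype.card (Fin I.1.2 ⊕ Fin I.1.1) * Fintype.card (Fin I.1.2 ⊕ Fin I.1.1) -
        relCard I.2.1.toSetoid) (fun I => ⟨powerSum I.2.1, hmem I⟩)
      (fun I => by
        rw [coeffs_apply, coeffAt_powerSum_self]
        exact one_ne_zero) h
    ⟨p, fun I => by rw [hp I]⟩
  rintro ⟨⟨n, m⟩, I⟩ ⟨⟨n', m'⟩, J⟩ h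
  rw [coeffs_apply] at h
  -- A nonzero coefficient forces both bidegrees to agree.
  obtain ⟨S, w, h0, hS, hw⟩ := le_of_coeffAt_ne_zero h
  have h0' : powerSum I.1 S w ≠ 0 := h0
  rw [powerSum] at h0'
  obtain ⟨hS', hw'⟩ := wordSum_ne_zero h0'
  dsimp only at hS hw hS' hw' h
  obtain rfl : n = n' := hw'.symm.trans hw
  obtain rfl : m = m' := hS'.symm.trans hS
  rcases coeffAt_powerSum_ne_zero h with rfl | hlt
  · exact Or.inl rfl
  · exact Or.inr (Nat.sub_lt_sub_left (hlt.trans_le (relCard_le J.1.toSetoid)) hlt)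

/-! ### Expanding block statistics into indicators of constancy -/

section expansion

variable {X : Type*}

/-- The equivalence relation generated by relating every point to its image under `f`. -/
def orbitSetoid (f : X → X) : Setoid X := sInf {s | ∀ k, s (f k) k}

theorem orbitSetoid_rel (f : X → X) (k : X) : orbitSetoid f (f k) k := by
  intro s hs
  exact hs k

theorem orbitSetoid_le_iff (f : X → X) (s : Setoid X) : orbitSetoid f ≤ s ↔ ∀ k, s (f k) k :=
  ⟨fun h k => h (orbitSetoid_rel f k), fun h => sInf_le h⟩

/-- Everything related to a fixed point `k` reaches `k` by iterating `f`, and iterates only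
decrease. -/
theorem le_of_orbitSetoid [LinearOrder X] {f : X → X} (hf : ∀ k, f k ≤ k) {k : X} (hk : f k = k)
    {j : X} (h : orbitSetoid f j k) : k ≤ j := by
  have hle : ∀ i x, f^[i] x ≤ x := by
    intro i
    induction i with
    | zero => exact fun x => le_rfl
    | succ i ih => exact fun x => (ih (f x)).trans (hf x)
  -- Whether the iterates of `x` reach `k` does not change when `x` is replaced by `f x`, so it is
  -- constant on classes; at `k` it holds.
  have h1 : orbitSetoid f ≤ Setoid.ker fun x => ∃ i, f^[i] x = k := by
    rw [orbitSetoid_le_iff]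
    refine fun x => propext ⟨fun ⟨i, hi⟩ => ⟨i + 1, hi⟩, fun ⟨i, hi⟩ => ?_⟩
    cases i with
    | zero =>
      obtain rfl : x = k := hi
      exact ⟨0, hk⟩
    | succ i => exact ⟨i, hi⟩
  have h2 : (∃ i, f^[i] j = k) = ∃ i, f^[i] k = k := h1 h
  obtain ⟨i, hi⟩ := h2.symm ▸ (⟨0, rfl⟩ : ∃ i, f^[i] k = k)
  exact hi ▸ hle i j

/-- The fixed points are the class minima, so they depend on the generated relation only. This
excludes cancellation in `exists_prod_expansion`. -/
theorem fixed_iff_of_orbitSetoid_eq [LinearOrder X] {f : X → X} (hf : ∀ k, f k ≤ k)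
    {K : Setoid X} (h : orbitSetoid f = K) (k : X) : f k = k ↔ ∀ j, K j k → k ≤ j := by
  subst h
  exact ⟨fun hk j hj => le_of_orbitSetoid hf hk hj,
    fun hk => le_antisymm (hf k) (hk _ (orbitSetoid_rel f k))⟩

theorem exists_orbitSetoid_eq [LinearOrder X] [Finite X] (K : Setoid X) :
    ∃ f : X → X, (∀ k, f k ≤ k ∧ K (f k) k) ∧ orbitSetoid f = K := by
  have hwf : WellFounded ((· < ·) : X → X → Prop) := Finite.to_wellFoundedLT.wf
  have hne : ∀ k, {j | K j k}.Nonempty := fun k => ⟨k, K.refl' k⟩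
  have hK : ∀ k, K (hwf.min _ (hne k)) k := fun k => hwf.min_mem _ (hne k)
  -- Send every point to the minimum of its class.
  refine ⟨fun k => hwf.min _ (hne k), fun k => ⟨?_, hK k⟩, le_antisymm ?_ ?_⟩
  · exact not_lt.1 (hwf.not_lt_min {j | K j k} (K.refl' k))
  · exact (orbitSetoid_le_iff _ _).2 hK
  · intro x y hxy
    have hs : {j | K j x} = {j | K j y} := by
      ext j
      exact ⟨fun h => K.trans' h hxy, fun h => K.trans' h (K.symm' hxy)⟩
    have e : hwf.min _ (hne x) = hwf.min _ (hne y) := by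
      congr 1
    have hx := orbitSetoid_rel (fun k => hwf.min _ (hne k)) x
    have hy := orbitSetoid_rel (fun k => hwf.min _ (hne k)) y
    exact Setoid.trans' _ (Setoid.symm' _ (e ▸ hx)) hy

noncomputable instance [Finite X] : Fintype (Setoid X) := Fintype.ofFinite _

-- Multiplying out means choosing `f k ≤ k` in the class of `k` for each `k`. The resulting term is
-- `s` to the number of non-fixed points, times the indicator that `c` is constant on the classes
-- generated by `f`; collect terms by that relation.
open Classical in
theorem exists_prod_expansion [Fintype X] [LinearOrder X] (K : Setoid X) {s : ℚ} (hs : s ≠ 0) :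
    ∃ w : Setoid X → ℚ, w K ≠ 0 ∧ (∀ r, w r ≠ 0 → r ≤ K) ∧ ∀ c : X → ℕ,
      ∑ r, (w r * if r ≤ Setoid.ker c then 1 else 0) =
        ∏ k, ∑ j ∈ Finset.univ.filter fun j => j ≤ k ∧ K j k,
          (if j = k then 1 else s) * if c j = c k then 1 else 0 := by
  let F : Finset (X → X) := Fintype.piFinset fun k => Finset.univ.filter fun j => j ≤ k ∧ K j k
  have hF : ∀ f, f ∈ F ↔ ∀ k, f k ≤ k ∧ K (f k) k := fun f => by simp [F]
  let d : (X → X) → ℕ := fun f => (Finset.univ.filter fun k => ¬ f k = k).card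
  refine ⟨fun r => ∑ f ∈ F with orbitSetoid f = r, s ^ d f, ?_, ?_, ?_⟩
  -- All maps generating `K` have equally many non-fixed points, so the weight of `K` is a positive
  -- number of copies of one power of `s`.
  · obtain ⟨f₀, h₀, h₀K⟩ := exists_orbitSetoid_eq K
    have hd : ∀ f ∈ F, orbitSetoid f = K → d f = d f₀ := by
      intro f hf hfK
      simp only [d]
      congr 2
      funext k
      rw [fixed_iff_of_orbitSetoid_eq (fun k => ((hF f).1 hf k).1) hfK,
        fixed_iff_of_orbitSetoid_eq (fun k => (h₀ k).1) h₀K]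
    have hsum : ∑ f ∈ F with orbitSetoid f = K, s ^ d f =
        ∑ f ∈ F with orbitSetoid f = K, s ^ d f₀ :=
      Finset.sum_congr rfl fun f hf => by
        rw [hd f (Finset.mem_filter.1 hf).1 (Finset.mem_filter.1 hf).2]
    change ∑ f ∈ F with orbitSetoid f = K, s ^ d f ≠ 0
    rw [hsum, Finset.sum_const, nsmul_eq_mul]
    refine mul_ne_zero (Nat.cast_ne_zero.2 (Finset.card_ne_zero.2 ⟨f₀, ?_⟩)) (pow_ne_zero _ hs)
    exact Finset.mem_filter.2 ⟨(hF f₀).2 h₀, h₀K⟩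
  · intro r hr
    obtain ⟨f, hf, -⟩ := Finset.exists_ne_zero_of_sum_ne_zero hr
    obtain ⟨hfF, rfl⟩ := Finset.mem_filter.1 hf
    exact (orbitSetoid_le_iff f K).2 fun k => ((hF f).1 hfF k).2
  · intro c
    rw [Finset.prod_univ_sum]
    have h1 : ∀ r : Setoid X, (∑ f ∈ F with orbitSetoid f = r, s ^ d f) *
        (if r ≤ Setoid.ker c then (1 : ℚ) else 0) =
        ∑ f ∈ F with orbitSetoid f = r, s ^ d f * if orbitSetoid f ≤ Setoid.ker c then 1 else 0 := by
      intro r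
      rw [Finset.sum_mul]
      exact Finset.sum_congr rfl fun f hf => by rw [(Finset.mem_filter.1 hf).2]
    refine (Finset.sum_congr rfl fun r _ => h1 r).trans ((Finset.sum_fiberwise F orbitSetoid
      fun f => s ^ d f * if orbitSetoid f ≤ Setoid.ker c then 1 else 0).trans ?_)
    refine Finset.sum_congr rfl fun f _ => ?_
    rw [Finset.prod_mul_distrib, Finset.prod_ite, Finset.prod_const_one, one_mul,
      Finset.prod_const, Finset.prod_boole]
    simp only [orbitSetoid_le_iff, Setoid.ker_def, Finset.mem_univ, forall_const]
    rfl

open Classical in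
/-- The indicator function of the labellings that are injective on the classes of `K`, as a
combination of the indicator functions of the labellings constant on the classes of `r ≤ K`. -/
theorem exists_injective_expansion [Fintype X] (K : Setoid X) :
    ∃ w : Setoid X → ℚ, w K ≠ 0 ∧ (∀ r, w r ≠ 0 → r ≤ K) ∧ ∀ c : X → ℕ,
      ∑ r, (w r * if r ≤ Setoid.ker c then 1 else 0) =
        if ∀ x y, x ≠ y → K x y → c x ≠ c y then 1 else 0 := by
  -- Any linear order will do.
  let _ : LinearOrder X := LinearOrder.lift' (Fintype.equivFin X) (Fintype.equivFin X).injective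
  obtain ⟨w, hK, hle, h⟩ := exists_prod_expansion K (s := -1) (by norm_num)
  refine ⟨w, hK, hle, fun c => ?_⟩
  rw [h]
  split_ifs with hc
  · refine Finset.prod_eq_one fun k _ => ?_
    rw [Finset.sum_eq_single k]
    · simp
    · intro j hj hjk
      rw [if_neg (hc j k hjk (Finset.mem_filter.1 hj).2.2), mul_zero]
    · exact fun hk => absurd (by simp) hk
  -- At the least `k` repeating the value of an earlier member of its class, that member is unique:
  -- two of them would already give a smaller repetition. The factor at `k` is then `1 - 1 = 0`.
  · have hex : {k | ∃ j, j < k ∧ K j k ∧ c j = c k}.Nonempty := by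
      push Not at hc
      obtain ⟨x, y, hxy, hK, e⟩ := hc
      rcases lt_or_gt_of_ne hxy with hlt | hlt
      · exact ⟨y, x, hlt, hK, e⟩
      · exact ⟨x, y, hlt, K.symm' hK, e.symm⟩
    have hwf : WellFounded ((· < ·) : X → X → Prop) := Finite.to_wellFoundedLT.wf
    obtain ⟨k, ⟨j, hjk, hKj, ej⟩, hmin⟩ := hwf.has_min _ hex
    refine Finset.prod_eq_zero (Finset.mem_univ k) ?_
    have huniq : ∀ j', j' < k → K j' k → c j' = c k → j' = j := by
      intro j' hlt' hK' e'
      by_contra hne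
      rcases lt_or_gt_of_ne hne with hlt | hlt
      · exact hmin j ⟨j', hlt, K.trans' hK' (K.symm' hKj), e'.trans ej.symm⟩ hjk
      · exact hmin j' ⟨j, hlt, K.trans' hKj (K.symm' hK'), ej.trans e'.symm⟩ hlt'
    rw [← Finset.sum_subset (s₁ := {j, k})]
    · rw [Finset.sum_pair hjk.ne]
      simp [hjk.ne, ej]
    · intro i hi
      rcases Finset.mem_insert.1 hi with rfl | hi
      · simp [hjk.le, hKj]
      · simp [Finset.mem_singleton.1 hi]
    · intro i hi hi'
      simp only [Finset.mem_filter, Finset.mem_univ, true_and, Finset.mem_insert,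
        Finset.mem_singleton, not_or] at hi hi'
      rw [if_neg (fun e => hi'.1 (huniq i (lt_of_le_of_ne hi.1 hi'.2) hi.2 e)), mul_zero]

/-- The factors are the ranks `1, 2, …, |B|` of the elements. -/
theorem prod_card_le_eq_factorial [LinearOrder X] (B : Finset X) :
    ∏ x ∈ B, (B.filter (· ≤ x)).card = B.card.factorial := by
  induction B using Finset.induction_on_max with
  | empty => rfl
  | insert a B hB ih =>
    have ha : a ∉ B := fun h => lt_irrefl a (hB a h)
    rw [Finset.prod_insert ha, Finset.card_insert_of_notMem ha, Nat.factorial_succ, ← ih]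
    congr 1
    · rw [Finset.filter_true_of_mem, Finset.card_insert_of_notMem ha]
      intro x hx
      rcases Finset.mem_insert.1 hx with rfl | hx
      · exact le_rfl
      · exact (hB x hx).le
    · refine Finset.prod_congr rfl fun x hx => ?_
      rw [Finset.filter_insert, if_neg (hB x hx).not_ge]

open Classical in
/-- The number of permutations preserving the classes of `K` and a labelling `c`, as a
combination of the indicator functions of the labellings constant on the classes of `r ≤ K`. -/
theorem exists_factorial_expansion [Fintype X] (K : Setoid X) :
    ∃ w : Setoid X → ℚ, w K ≠ 0 ∧ (∀ r, w r ≠ 0 → r ≤ K) ∧ ∀ (c : X → ℕ) (T : Type)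
      [Fintype T] (g : X → T), Setoid.ker g = K ⊓ Setoid.ker c →
      ∑ r, (w r * if r ≤ Setoid.ker c then 1 else 0) =
        ((∏ t, (Finset.univ.filter fun x => g x = t).card.factorial : ℕ) : ℚ) := by
  let _ : LinearOrder X := LinearOrder.lift' (Fintype.equivFin X) (Fintype.equivFin X).injective
  -- With `s = 1` the factor at `k` counts the `j ≤ k` in the class of `k` under `K ⊓ ker c`, that
  -- is, in its fibre under `g`.
  obtain ⟨w, hK, hle, h⟩ := exists_prod_expansion K (s := 1) one_ne_zero
  refine ⟨w, hK, hle, fun c T _ g hg => ?_⟩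
  have hg' : ∀ x y, g x = g y ↔ K x y ∧ c x = c y := fun x y => Setoid.ext_iff.1 hg x y
  rw [h, Nat.cast_prod, ← Finset.prod_fiberwise Finset.univ g]
  refine Finset.prod_congr rfl fun t _ => ?_
  rw [← prod_card_le_eq_factorial, Nat.cast_prod]
  refine Finset.prod_congr rfl fun k hk => ?_
  obtain rfl := (Finset.mem_filter.1 hk).2
  simp only [ite_self, one_mul]
  rw [Finset.sum_boole, Finset.filter_filter, Finset.filter_filter]
  congr 2
  ext j
  simp only [Finset.mem_filter, Finset.mem_univ, true_and, hg']
  tauto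

end expansion

/-! ### From expansions to bases: elementary and complete homogeneous functions -/

theorem toSetoid_separates {K : SetSupercomposition n m} {r : Setoid (Fin m ⊕ Fin n)}
    (h : r ≤ K.toSetoid) (i i' : Fin m) (hi : r (.inl i) (.inl i')) : i = i' :=
  K.toSetoid_inl_inl.1 (h hi)

/-- Series that are triangular with respect to the power sums form a basis. -/
theorem exists_basis_of_expansion (v : (Σ d : ℕ × ℕ, SetSuperpartition d.1 d.2) → Series)
    (hv : ∀ I, ∃ w : Setoid (Fin I.1.2 ⊕ Fin I.1.1) → ℚ, w I.2.1.toSetoid ≠ 0 ∧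
      (∀ r, w r ≠ 0 → r ≤ I.2.1.toSetoid) ∧ v I = ∑ r, w r • constSum r) :
    ∃ b : Module.Basis (Σ d : ℕ × ℕ, SetSuperpartition d.1 d.2) ℚ sNCSym,
      ∀ I, (b I : Series) = v I := by
  obtain ⟨p, hp⟩ := exists_powerSum_basis
  choose w hw hle hvw using hv
  let P : ∀ {n m : ℕ}, Setoid (Fin m ⊕ Fin n) → sNCSym := fun r => ⟨constSum r, constSum_mem r⟩
  let u : (Σ d : ℕ × ℕ, SetSuperpartition d.1 d.2) → sNCSym := fun I => ∑ r, w I r • P r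
  have hu : ∀ I, (u I : Series) = v I := by
    intro I
    rw [hvw I]
    exact map_sum sNCSym.val (fun r => w I r • P r) Finset.univ
  have hrepr : ∀ I J, p.repr (u I) J = ∑ r, w I r * p.repr (P r) J := by
    intro I J
    simp only [u, map_sum, map_smul, Finsupp.finsetSum_apply, Finsupp.smul_apply, smul_eq_mul]
  have hself : ∀ I : Σ d : ℕ × ℕ, SetSuperpartition d.1 d.2, P I.2.1.toSetoid = p I := by
    intro I
    exact Subtype.ext (by rw [hp I, powerSum_eq_constSum])
  -- The series of a relation `r` below `I` has nonzero power sum coordinates only at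
  -- superpartitions with as many related pairs as `r`.
  have hcard : ∀ (I J : Σ d : ℕ × ℕ, SetSuperpartition d.1 d.2)
      (r : Setoid (Fin I.1.2 ⊕ Fin I.1.1)), r ≤ I.2.1.toSetoid → p.repr (P r) J ≠ 0 →
      relCard J.2.1.toSetoid = relCard r := by
    intro I J r hr h
    rcases constSum_eq_zero_or (toSetoid_separates hr) with h0 | ⟨J', ε, hJ', hc⟩
    · have : P r = 0 := Subtype.ext h0
      simp [this] at h
    · have : P r = ε • p ⟨I.1, J'⟩ := Subtype.ext (by
        rw [← hself ⟨I.1, J'⟩]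
        change constSum r = ε • constSum J'.1.toSetoid
        rw [hJ', powerSum_eq_constSum])
      rw [this, map_smul, p.repr_self, Finsupp.smul_apply] at h
      by_cases e : (⟨I.1, J'⟩ : Σ d : ℕ × ℕ, SetSuperpartition d.1 d.2) = J
      · subst e
        exact hc
      · rw [Finsupp.single_eq_of_ne (Ne.symm e), smul_zero] at h
        exact absurd rfl h
  obtain ⟨b, hb⟩ := exists_basis_of_triangular p.repr.toLinearMap p.repr.injective
    (fun I => relCard I.2.1.toSetoid) u
    (fun I => by
      change p.repr (u I) I ≠ 0
      rw [hrepr, Finset.sum_eq_single I.2.1.toSetoid]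
      · rw [hself, p.repr_self, Finsupp.single_eq_same, mul_one]
        exact hw I
      · intro r _ hr
        by_contra h
        have hrI := hle I r (left_ne_zero_of_mul h)
        exact hr (eq_of_relCard_le hrI (hcard I I r hrI (right_ne_zero_of_mul h)).le)
      · exact fun h => absurd (Finset.mem_univ _) h)
    (fun I J h => by
      change p.repr (u I) J ≠ 0 at h
      rw [hrepr] at h
      obtain ⟨r, -, hr⟩ := Finset.exists_ne_zero_of_sum_ne_zero h
      have hrI := hle I r (left_ne_zero_of_mul hr)
      have hc := hcard I J r hrI (right_ne_zero_of_mul hr)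
      -- If no pairs are lost, `r` is the relation of `I`, whose series is the basis vector `p I`;
      -- otherwise the rank drops.
      rcases (relCard_mono hrI).lt_or_eq with hlt | heq
      · exact Or.inr (hc ▸ hlt)
      · left
        rw [eq_of_relCard_le hrI heq.ge, hself, p.repr_self] at hr
        by_contra hJ
        exact right_ne_zero_of_mul hr (Finsupp.single_eq_of_ne hJ))
  exact ⟨b, fun I => by rw [hb, hu]⟩

open Classical in
theorem sum_smul_constSum (w : Setoid (Fin m ⊕ Fin n) → ℚ) :
    ∑ r, w r • constSum r =
      wordSum fun a b => ∑ r, (w r * if r ≤ Setoid.ker (Sum.elim a b) then 1 else 0) := by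
  rw [wordSum_sum]
  exact Finset.sum_congr rfl fun r _ => (wordSum_smul (w r) _).symm

/-- The condition defining `e_K` is injectivity of the index map on classes, since distinct
θ-positions never share a class. -/
theorem elementary_expansion (K : SetSupercomposition n m) :
    ∃ w : Setoid (Fin m ⊕ Fin n) → ℚ, w K.toSetoid ≠ 0 ∧ (∀ r, w r ≠ 0 → r ≤ K.toSetoid) ∧
      elementary K = ∑ r, w r • constSum r := by
  classical
  obtain ⟨w, hK, hle, h⟩ := exists_injective_expansion K.toSetoid
  refine ⟨w, hK, hle, ?_⟩
  rw [sum_smul_constSum, elementary]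
  congr 1
  funext a b
  rw [h]
  have key : ((∀ i j, j.succ ∈ K.ferm i → a i ≠ b j) ∧
      ∀ j k, j ≠ k → K.SameBlock j k → b j ≠ b k) ↔
      ∀ x y, x ≠ y → K.toSetoid x y → Sum.elim a b x ≠ Sum.elim a b y := by
    refine ⟨?_, fun h => ⟨fun i j hij => h (.inl i) (.inr j) (by simp) (K.toSetoid_inl_inr.2 hij),
      fun j k hjk h' => h (.inr j) (.inr k) (by simpa using hjk) (K.toSetoid_inr_inr.2 h')⟩⟩
    rintro ⟨h1, h2⟩ (i | j) (i' | k) hne h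
    · exact absurd (congrArg Sum.inl (K.toSetoid_inl_inl.1 h)) hne
    · exact h1 i k (K.toSetoid_inl_inr.1 h)
    · exact (h1 i' j (K.toSetoid_inl_inr.1 (K.toSetoid.symm' h))).symm
    · exact h2 j k (fun e => hne (congrArg Sum.inr e)) (K.toSetoid_inr_inr.1 h)
  by_cases hc : ∀ x y, x ≠ y → K.toSetoid x y → Sum.elim a b x ≠ Sum.elim a b y
  · rw [if_pos hc, if_pos (key.2 hc)]
  · rw [if_neg hc, if_neg fun h => hc (key.1 h)]

/-- The θ-position `inl i` plays the role of the element 0 of the fermionic block. -/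
theorem card_blockOf_eq_inl (K : SetSupercomposition n m) (i : Fin m)
    [DecidableEq (Fin m ⊕ Finset (Fin (n + 1)))] :
    (Finset.univ.filter fun x => K.blockOf x = .inl i).card = (K.ferm i).card := by
  refine Finset.card_bij (fun x _ => Sum.elim (fun _ => 0) Fin.succ x) ?_ ?_ ?_
  · rintro (i' | j) hx
    · exact K.zero_mem_ferm i
    · exact K.blockOf_inr_eq_inl.1 (by simpa using hx)
  · rintro (i' | j) hx (i'' | k) hy e
    · have hx' : Sum.inl i' = Sum.inl i := (Finset.mem_filter.1 hx).2
      have hy' : Sum.inl i'' = Sum.inl i := (Finset.mem_filter.1 hy).2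
      rw [Sum.inl_injective hx', Sum.inl_injective hy']
    · exact absurd e.symm (Fin.succ_ne_zero k)
    · exact absurd e (Fin.succ_ne_zero j)
    · exact congrArg Sum.inr (Fin.succ_injective _ e)
  · intro k hk
    induction k using Fin.cases with
    | zero => exact ⟨.inl i, Finset.mem_filter.2 ⟨Finset.mem_univ _, rfl⟩, rfl⟩
    | succ j => exact ⟨.inr j, by simpa using K.blockOf_inr_eq_inl.2 hk, rfl⟩

theorem blockOf_inl_ne_inr (K : SetSupercomposition n m) (i : Fin m) (B : Finset (Fin (n + 1))) :
    K.blockOf (.inl i) ≠ .inr B := Sum.inl_ne_inr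

theorem card_blockOf_eq_inr (K : SetSupercomposition n m) {B : Finset (Fin (n + 1))}
    (hB : B ∈ K.nonferm) [DecidableEq (Fin m ⊕ Finset (Fin (n + 1)))] :
    (Finset.univ.filter fun x => K.blockOf x = .inr B).card = B.card := by
  refine Finset.card_bij (fun x _ => Sum.elim (fun _ => 0) Fin.succ x) ?_ ?_ ?_
  · rintro (i' | j) hx
    · exact absurd (Finset.mem_filter.1 hx).2 (blockOf_inl_ne_inr K _ _)
    · exact (K.blockOf_inr_eq_inr.1 (Finset.mem_filter.1 hx).2).2
  · rintro (i' | j) hx (i'' | k) hy e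
    · exact absurd (Finset.mem_filter.1 hx).2 (blockOf_inl_ne_inr K _ _)
    · exact absurd (Finset.mem_filter.1 hx).2 (blockOf_inl_ne_inr K _ _)
    · exact absurd (Finset.mem_filter.1 hy).2 (blockOf_inl_ne_inr K _ _)
    · exact congrArg Sum.inr (Fin.succ_injective _ e)
  · intro k hk
    obtain ⟨j, rfl⟩ := Fin.exists_succ_eq.2 (K.ne_zero_of_mem hB hk)
    exact ⟨.inr j, by simpa using K.blockOf_inr_eq_inr.2 ⟨hB, hk⟩, rfl⟩

/-- Sets that are not blocks have empty fibres and contribute `0! = 1`. -/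
theorem prod_factorial_card_blockOf (K : SetSupercomposition n m)
    [DecidableEq (Fin m ⊕ Finset (Fin (n + 1)))] :
    ∏ t, (Finset.univ.filter fun x => K.blockOf x = t).card.factorial = K.factorial := by
  rw [Fintype.prod_sum_type, factorial]
  congr 1
  · exact Finset.prod_congr rfl fun i _ => by rw [card_blockOf_eq_inl]
  · rw [← Finset.prod_subset (Finset.subset_univ K.nonferm)]
    · exact Finset.prod_congr rfl fun B hB => by rw [card_blockOf_eq_inr K hB]
    · intro B _ hB
      rw [Finset.filter_false_of_mem, Finset.card_empty, Nat.factorial_zero]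
      rintro (i | j) _ h
      · cases h
      · exact hB (K.blockOf_inr_eq_inr.1 h).1

theorem completeHomogeneous_expansion (K : SetSupercomposition n m) :
    ∃ w : Setoid (Fin m ⊕ Fin n) → ℚ, w K.toSetoid ≠ 0 ∧ (∀ r, w r ≠ 0 → r ≤ K.toSetoid) ∧
      completeHomogeneous K = ∑ r, w r • constSum r := by
  classical
  obtain ⟨w, hK, hle, h⟩ := exists_factorial_expansion K.toSetoid
  refine ⟨w, hK, hle, ?_⟩
  have hmem : ∑ r, w r • constSum r ∈ sNCSym :=
    sum_mem fun r _ => sNCSym.smul_mem (constSum_mem r) (w r)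
  have himage : ∀ {k : ℕ} (b : Fin k → ℕ), Finset.univ.image b = (List.ofFn b).toFinset := by
    intro k b
    ext y
    simp
  ext S l
  -- Null-symmetry depends only on the normal form. There `h_K` has no terms, and the right-hand
  -- side vanishes because it is symmetric, although its individual weights need not.
  by_cases hnull : 1 < (S \ l.toFinset).card
  · obtain ⟨a, b, ha, hS, hl⟩ := exists_word_eq S l
    have h0 := apply_eq_zero_of_nullSymmetric hmem ha (b := b)
      (by rwa [NullSymmetric, himage b, hS, hl])
    rw [hS, hl] at h0
    rw [h0, completeHomogeneous, wordSum_apply]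
    refine finsum_eq_zero_of_forall_eq_zero fun u => ?_
    by_contra hne
    obtain ⟨-, hS, hl⟩ := of_word_ne_zero (right_ne_zero_of_mul hne)
    refine left_ne_zero_of_mul hne (dif_neg fun hd => hd.2.1 ?_)
    rwa [NullSymmetric, himage u.2, ← hS, ← hl]
  · rw [sum_smul_constSum, completeHomogeneous, wordSum_apply, wordSum_apply]
    refine finsum_congr fun u => ?_
    by_cases hu : word u.1 u.2 S l = 0
    · rw [hu, mul_zero, mul_zero]
    · obtain ⟨ha, hS, hl⟩ := of_word_ne_zero hu
      congr 1
      have hL : ∃ L : SetSupercomposition n m, MemM L u.1 u.2 :=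
        ⟨ofSetoid (Setoid.ker (Sum.elim u.1 u.2)) (fun i i' h => ha h) K.le_succ,
          (memM_iff _ ha _).2 (toSetoid_ofSetoid _ _ _)⟩
      have hd : Function.Injective u.1 ∧ ¬ NullSymmetric u.1 u.2 ∧
          ∃ L : SetSupercomposition n m, MemM L u.1 u.2 :=
        ⟨ha, by rwa [NullSymmetric, himage u.2, ← hS, ← hl], hL⟩
      -- The chosen pattern has the kernel of the indices as its relation, so the blocks of the meet
      -- are the fibres to which the factorial expansion applies.
      have hker : Setoid.ker (K ⊓ hd.2.2.choose).blockOf =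
          K.toSetoid ⊓ Setoid.ker (Sum.elim u.1 u.2) := by
        rw [← (memM_iff _ ha _).1 hd.2.2.choose_spec, ← toSetoid_inf]
        rfl
      rw [dif_pos hd, h _ _ _ hker, ← prod_factorial_card_blockOf]
      congr!

end Superspace

theorem mainTheorem2 :
    (∃ p : Module.Basis (Σ d : ℕ × ℕ, Superspace.SetSuperpartition d.1 d.2) ℚ Superspace.sNCSym,
      ∀ I, (p I : Superspace.Series) = Superspace.powerSum I.2.1) ∧
    (∃ e : Module.Basis (Σ d : ℕ × ℕ, Superspace.SetSuperpartition d.1 d.2) ℚ Superspace.sNCSym,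
      ∀ I, (e I : Superspace.Series) = Superspace.elementary I.2.1) ∧
    (∃ h : Module.Basis (Σ d : ℕ × ℕ, Superspace.SetSuperpartition d.1 d.2) ℚ Superspace.sNCSym,
      ∀ I, (h I : Superspace.Series) = Superspace.completeHomogeneous I.2.1) :=
  ⟨Superspace.exists_powerSum_basis,
    Superspace.exists_basis_of_expansion (fun I => Superspace.elementary I.2.1)
      fun I => Superspace.elementary_expansion I.2.1,
    Superspace.exists_basis_of_expansion (fun I => Superspace.completeHomogeneous I.2.1)
      fun I => Superspace.completeHomogeneous_expansion I.2.1⟩
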